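/- Let $\mathbb G$ be a homogeneous Lie group, that is, $\mathbb R^N$ with a Lie group law such that for some weights $\nu_1,\dots,\nu_N>0$ every dilation $D_r(x)=(r^{\nu_1}x_1,\dots,r^{\nu_N}x_N)$, $r>0$, is a group automorphism; let $Q=\nu_1+\dots+\nu_N$ be its homogeneous dimension and $dx$ a Haar measure on $\mathbb G$. Let $|\cdot|:\mathbb G\to[0,\infty)$ be an arbitrary homogeneous quasi-norm: a continuous function with $|x^{-1}|=|x|$, $|D_r x|=r|x|$ for all $r>0$, and $|x|=0$ if and only if $x=0$. For $0<\lambda<Q$ put $$I_{\lambda}u(x)=\int_{\mathbb G}\frac{u(y)}{|y^{-1}x|^{\lambda}}\,dy .$$ Assume $0<\lambda<Q$, $1<p\le q<\infty$, $\frac1p+\frac1{p'}=1$, $\frac1q+\frac1{q'}=1$, $\alpha<\frac{Q}{p'}$, $\beta<\frac Qq$, $\alpha+\beta\ge 0$ and $$\frac1q=\frac1p+\frac{\alpha+\beta+\lambda}{Q}-1 .$$ Then there is a constant $C>0$, independent of the functions $u$ and $h$ below, such that: 1. for every (real- or complex-valued) $u$ with $|x|^{\alpha}u\in L^p(\mathbb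 G)$, the integral $I_\lambda u(x)$ converges absolutely for almost every $x$, $|x|^{-\beta}I_\lambda u\in L^q(\mathbb G)$, and $$\big\||x|^{-\beta}I_{\lambda}u\big\|_{L^q(\mathbb G)}\le C\,\big\||x|^{\alpha}u\big\|_{L^p(\mathbb G)};$$ 2. for all (real- or complex-valued) $u\in L^p(\mathbb G)$ and $h\in L^{q'}(\mathbb G)$, the following double integral converges absolutely and $$\left|\int_{\mathbb G}\int_{\mathbb G}\frac{u(y)\,h(x)}{|x|^{\beta}\,|y^{-1}x|^{\lambda}\,|y|^{\alpha}}\,dx\,dy\right|\le C\,\|u\|_{L^p(\mathbb G)}\,\|h\|_{L^{q'}(\mathbb G)} .$$ -/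

import Mathlib

open MeasureTheory
open scoped ENNReal Manifold ContDiff

noncomputable section

namespace SteinWeiss

/-- The dilation `D_r (x₁, …, x_N) = (r ^ ν₁ x₁, …, r ^ ν_N x_N)` of `ℝ^N` with weights `ν`. -/
def dilation {N : ℕ} (ν : Fin N → ℝ) (r : ℝ) (x : EuclideanSpace ℝ (Fin N)) :
    EuclideanSpace ℝ (Fin N) :=
  WithLp.toLp 2 fun i => r ^ ν i * x i

/-- A group law on `ℝ^N` makes `ℝ^N` a homogeneous (Lie) group with dilation weights `ν` if it is
a Lie group for the standard smooth structure of `ℝ^N`, the weights are positive, and every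
dilation `D_r`, `r > 0`, is an automorphism of the group. (`D_r` is a bijection with inverse
`D_{1/r}`, so that only multiplicativity has to be required.) The group law is a multiplicative
one and is not related to the vector addition of `ℝ^N`; its identity element is automatically the
origin, the only point fixed by all dilations. -/
structure IsHomogeneousGroup {N : ℕ} [Group (EuclideanSpace ℝ (Fin N))] (ν : Fin N → ℝ) :
    Prop where
  lieGroup : LieGroup 𝓘(ℝ, EuclideanSpace ℝ (Fin N)) ∞ (EuclideanSpace ℝ (Fin N))
  weight_pos : ∀ i, 0 < ν i
  dilation_mul : ∀ r : ℝ, 0 < r → ∀ x y : EuclideanSpace ℝ (Fin N),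
    dilation ν r (x * y) = dilation ν r x * dilation ν r y

/-- The homogeneous dimension `Q = ν₁ + … + ν_N`. -/
def homogeneousDim {N : ℕ} (ν : Fin N → ℝ) : ℝ := ∑ i, ν i

/-- A homogeneous quasi-norm: a continuous non-negative function, symmetric under group inversion,
homogeneous of degree one under the dilations, and vanishing exactly at the origin. -/
structure IsHomogeneousQuasiNorm {N : ℕ} [Group (EuclideanSpace ℝ (Fin N))] (ν : Fin N → ℝ)
    (ρ : EuclideanSpace ℝ (Fin N) → ℝ) : Prop where
  continuous : Continuous ρ
  nonneg : ∀ x, 0 ≤ ρ x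
  inv : ∀ x, ρ x⁻¹ = ρ x
  dilation : ∀ r : ℝ, 0 < r → ∀ x, ρ (dilation ν r x) = r * ρ x
  eq_zero_iff : ∀ x, ρ x = 0 ↔ x = 0

/-- The integral operator `I_{l,ρ} u (x) = ∫ u(y) / ρ(y⁻¹ x)^l dy`. -/
def fractionalIntegral {N : ℕ} [Group (EuclideanSpace ℝ (Fin N))] {𝕜 : Type*} [RCLike 𝕜]
    (μ : Measure (EuclideanSpace ℝ (Fin N))) (ρ : EuclideanSpace ℝ (Fin N) → ℝ) (l : ℝ)
    (u : EuclideanSpace ℝ (Fin N) → 𝕜) (x : EuclideanSpace ℝ (Fin N)) : 𝕜 :=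
  ∫ y, ρ (y⁻¹ * x) ^ (-l) • u y ∂μ

end SteinWeiss

end

/-!
The inequality holds on every quasi-metric space whose measure satisfies `μ (B (y, r)) ≤ A r ^ Q`
(`IsUpperRegular`), with a base point `o` in place of the origin; a homogeneous group with
`d x y = ρ (y⁻¹ * x)` is such a space.

Everything follows from the bilinear estimate for non-negative `f`, `h` with `‖f‖_p ≤ 1` and
`‖h‖_q' ≤ 1`. Write `|x|` for `d x o` and split the pairs `(x, y)` according to the sizes of `|x|`
and `|y|`.

* If `K |y| < |x|`, then `d x y` is at least `|x| / K`, the kernel is at most a multiple of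
  `|x| ^ (-β - l) |y| ^ (-α)`, and Hardy's inequality applies (`lintegral_hardy_le`): this uses
  `α < Q / p'`. The region `K |x| < |y|` is the same after exchanging `(f, p, α)` and `(h, q', β)`,
  and uses `β < Q / q`.
* If `|x|` and `|y|` are comparable, `α + β ≥ 0` allows replacing the kernel by
  `d x y ^ (-(α + β + l))`. The resulting Hardy–Littlewood–Sobolev inequality is proved without
  interpolation: by symmetry only pairs with `h x ^ q' ≤ f y ^ p` matter, and for fixed `y` the
  integral over `x` is cut at the radius `R` with `R ^ (-Q) = f y ^ p`. Inside, `h` is bounded by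
  `f y ^ (p / q')`; outside, Hölder's inequality is used. Both parts are at most a multiple of
  `f y ^ (p - 1)` (`lintegral_riesz_sublevel_le`). For `p = q` the order `α + β + l` equals `Q` and
  the replaced kernel is not locally integrable; there `|y| ^ (-(α + β)) d x y ^ (-l)` has bounded
  integral over `d x y ≤ K ^ 2 |y|`, and the same cutting along `h x ^ q' ≤ f y ^ p` applies
  (`lintegral_comparable_sublevel_le`).

The operator form follows from the bilinear one by the converse of Hölder's inequality.

For the group, the quasi-triangle inequality comes from compactness of the unit ball. The growth of
balls needs Haar measure to scale with the homogeneous dimension, for which Lebesgue measure is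
shown to be a Haar measure: the Jacobian of the left translation by `x` at the origin is continuous
in `x` and constant along the dilation orbits, which accumulate at the identity, so it equals one.
-/

namespace SteinWeiss

/-! ### Integrals of powers of a quasi-distance -/

/-- A symmetric quasi-distance `d` on a measure space, with quasi-triangle constant `K`, whose balls
of radius `r` have measure at most `A * r ^ Q`. Points at distance zero need not be equal, and no
lower bound on the measure of balls is asked for. -/
structure IsUpperRegular {X : Type*} [MeasurableSpace X] (μ : Measure X) (d : X → X → ℝ)
    (K Q A : ℝ) : Prop where
  measurable : Measurable fun z : X × X => d z.1 z.2
  nonneg : ∀ x y, 0 ≤ d x y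
  symm : ∀ x y, d x y = d y x
  one_le : 1 ≤ K
  triangle : ∀ x y z, d x z ≤ K * max (d x y) (d y z)
  dim_pos : 0 < Q
  const_nonneg : 0 ≤ A
  measure_ball_le : ∀ y r, 0 < r → μ {x | d x y < r} ≤ ENNReal.ofReal (A * r ^ Q)

section UpperRegular

variable {X : Type*} [MeasurableSpace X] {μ : Measure X} {d : X → X → ℝ} {K Q A : ℝ}

lemma IsUpperRegular.measurable_left (H : IsUpperRegular μ d K Q A) (y : X) :
    Measurable fun x => d x y :=
  H.measurable.comp (measurable_id.prodMk measurable_const)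

lemma IsUpperRegular.measurable_right (H : IsUpperRegular μ d K Q A) (x : X) :
    Measurable fun y => d x y :=
  H.measurable.comp (measurable_const.prodMk measurable_id)

/-- The set of points at distance zero from `y` is null, since its measure is at most `A * r ^ Q`
for every `r > 0`. -/
lemma IsUpperRegular.ae_dist_pos (H : IsUpperRegular μ d K Q A) (y : X) :
    ∀ᵐ x ∂μ, 0 < d x y := by
  rw [ae_iff]
  have key : ∀ r : ℝ, 0 < r → μ {x | ¬ 0 < d x y} ≤ ENNReal.ofReal (A * r ^ Q) := fun r hr =>
    (measure_mono fun x (hx : ¬ 0 < d x y) => lt_of_le_of_lt (not_lt.1 hx) hr).trans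
      (H.measure_ball_le y r hr)
  have lim : Filter.Tendsto (fun r : ℝ => ENNReal.ofReal (A * r ^ Q)) (nhdsWithin 0 (Set.Ioi 0))
      (nhds 0) := by
    have : Filter.Tendsto (fun r : ℝ => A * r ^ Q) (nhds 0) (nhds (A * 0 ^ Q)) :=
      ((Real.continuousAt_rpow_const 0 Q (Or.inr H.dim_pos.le)).tendsto).const_mul A
    rw [Real.zero_rpow H.dim_pos.ne', mul_zero] at this
    simpa using ENNReal.tendsto_ofReal (this.mono_left nhdsWithin_le_nhds)
  refine nonpos_iff_eq_zero.1 (ge_of_tendsto lim ?_)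
  filter_upwards [self_mem_nhdsWithin] with r hr using key r hr

/-- On the shell `t ≤ d x y ≤ 2 t` the integrand is comparable to `t ^ (-a)`. -/
lemma IsUpperRegular.lintegral_shell_le (H : IsUpperRegular μ d K Q A) (a : ℝ) (y : X) {t : ℝ}
    (ht : 0 < t) :
    ∫⁻ x in {x | t ≤ d x y ∧ d x y ≤ 2 * t}, ENNReal.ofReal (d x y ^ (-a)) ∂μ ≤
      ENNReal.ofReal (2 ^ |a| * A * 4 ^ Q) * ENNReal.ofReal (t ^ (Q - a)) := by
  have hpt : ∀ s, t ≤ s → s ≤ 2 * t → s ^ (-a) ≤ 2 ^ |a| * t ^ (-a) := by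
    intro s h1 h2
    have hs : 0 < s := ht.trans_le h1
    have : s ^ (-a) = (s / t) ^ (-a) * t ^ (-a) := by
      rw [← Real.mul_rpow (by positivity) ht.le, div_mul_cancel₀ _ ht.ne']
    rw [this]
    gcongr
    have h1' : 1 ≤ s / t := by rwa [le_div_iff₀ ht, one_mul]
    calc (s / t) ^ (-a) ≤ (s / t) ^ |a| := Real.rpow_le_rpow_of_exponent_le h1' (neg_le_abs a)
      _ ≤ 2 ^ |a| := Real.rpow_le_rpow (by positivity) (by rwa [div_le_iff₀ ht]) (abs_nonneg a)
  calc ∫⁻ x in {x | t ≤ d x y ∧ d x y ≤ 2 * t}, ENNReal.ofReal (d x y ^ (-a)) ∂μ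
      ≤ ∫⁻ x in {x | t ≤ d x y ∧ d x y ≤ 2 * t}, ENNReal.ofReal (2 ^ |a| * t ^ (-a)) ∂μ := by
        refine setLIntegral_mono measurable_const fun x hx => ?_
        exact ENNReal.ofReal_le_ofReal (hpt _ hx.1 hx.2)
    _ ≤ ENNReal.ofReal (2 ^ |a| * t ^ (-a)) * ENNReal.ofReal (A * (4 * t) ^ Q) := by
        rw [setLIntegral_const]
        gcongr
        refine (measure_mono fun x hx => ?_).trans (H.measure_ball_le y (4 * t) (by positivity))
        have := hx.2
        simp only [Set.mem_ofPred_eq]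
        linarith
    _ = ENNReal.ofReal (2 ^ |a| * A * 4 ^ Q) * ENNReal.ofReal (t ^ (Q - a)) := by
        have hA := H.const_nonneg
        rw [← ENNReal.ofReal_mul (by positivity), ← ENNReal.ofReal_mul (by positivity)]
        congr 1
        rw [Real.mul_rpow (by norm_num) ht.le, sub_eq_add_neg, Real.rpow_add ht]
        ring

/-- Summing a geometric series over the shells `R θ ^ k ≤ d x y ≤ 2 R θ ^ k`. -/
lemma IsUpperRegular.lintegral_le_of_shells (H : IsUpperRegular μ d K Q A) {a θ : ℝ}
    (hθ : 0 < θ) (hlt : θ ^ (Q - a) < 1) :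
    ∃ C : ℝ≥0∞, C ≠ ⊤ ∧ ∀ (y : X) (R : ℝ) (S : Set X), 0 < R →
      (∀ᵐ x ∂μ, x ∈ S → ∃ k : ℕ, R * θ ^ k ≤ d x y ∧ d x y ≤ 2 * (R * θ ^ k)) →
      ∫⁻ x in S, ENNReal.ofReal (d x y ^ (-a)) ∂μ ≤ C * ENNReal.ofReal (R ^ (Q - a)) := by
  refine ⟨ENNReal.ofReal (2 ^ |a| * A * 4 ^ Q) * (1 - ENNReal.ofReal (θ ^ (Q - a)))⁻¹,
    ENNReal.mul_ne_top ENNReal.ofReal_ne_top ?_, fun y R S hR hS => ?_⟩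
  · rw [ENNReal.inv_ne_top]
    exact (tsub_pos_of_lt (by simpa using hlt)).ne'
  · calc ∫⁻ x in S, ENNReal.ofReal (d x y ^ (-a)) ∂μ
        ≤ ∫⁻ x in ⋃ k : ℕ, {x | R * θ ^ k ≤ d x y ∧ d x y ≤ 2 * (R * θ ^ k)},
            ENNReal.ofReal (d x y ^ (-a)) ∂μ := by
          refine lintegral_mono_set' ?_
          filter_upwards [hS] with x hx hxS
          exact Set.mem_iUnion.2 (hx hxS)
      _ ≤ ∑' k : ℕ, ∫⁻ x in {x | R * θ ^ k ≤ d x y ∧ d x y ≤ 2 * (R * θ ^ k)},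
            ENNReal.ofReal (d x y ^ (-a)) ∂μ := lintegral_iUnion_le _ _
      _ ≤ ∑' k : ℕ, ENNReal.ofReal (2 ^ |a| * A * 4 ^ Q) *
            (ENNReal.ofReal (R ^ (Q - a)) * ENNReal.ofReal (θ ^ (Q - a)) ^ k) := by
          refine ENNReal.tsum_le_tsum fun k => ?_
          refine (H.lintegral_shell_le a y (by positivity)).trans_eq ?_
          congr 1
          rw [← ENNReal.ofReal_pow (by positivity), ← ENNReal.ofReal_mul (by positivity),
            Real.mul_rpow hR.le (by positivity), ← Real.rpow_natCast, ← Real.rpow_natCast,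
            ← Real.rpow_mul hθ.le, ← Real.rpow_mul hθ.le, mul_comm (k : ℝ)]
      _ = _ := by
          rw [ENNReal.tsum_mul_left, ENNReal.tsum_mul_left, ENNReal.tsum_geometric]
          ring

/-- Local integrability of `d ^ (-a)` for `a` below the dimension. -/
lemma IsUpperRegular.lintegral_ball_le (H : IsUpperRegular μ d K Q A) {a : ℝ} (ha : a < Q) :
    ∃ C : ℝ≥0∞, C ≠ ⊤ ∧ ∀ (y : X) (R : ℝ), 0 < R →
      ∫⁻ x in {x | d x y ≤ R}, ENNReal.ofReal (d x y ^ (-a)) ∂μ ≤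
        C * ENNReal.ofReal (R ^ (Q - a)) := by
  have hlt : (1 / 2 : ℝ) ^ (Q - a) < 1 :=
    Real.rpow_lt_one (by norm_num) (by norm_num) (by linarith)
  obtain ⟨C, hC, h⟩ := H.lintegral_le_of_shells (by norm_num) hlt
  refine ⟨C * ENNReal.ofReal ((1 / 2) ^ (Q - a)), ENNReal.mul_ne_top hC ENNReal.ofReal_ne_top,
    fun y R hR => (h y (R * (1 / 2)) _ (by positivity) ?_).trans_eq ?_⟩
  · filter_upwards [H.ae_dist_pos y] with x hx hxR
    obtain ⟨n, hn1, hn2⟩ := exists_nat_pow_near_of_lt_one (x := d x y / R) (y := 1 / 2)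
      (by positivity) (by rw [div_le_one hR]; exact hxR) (by norm_num) (by norm_num)
    rw [lt_div_iff₀ hR] at hn1
    rw [div_le_iff₀ hR] at hn2
    refine ⟨n, ?_, ?_⟩
    · rw [pow_succ] at hn1; linarith
    · linarith
  · rw [Real.mul_rpow hR.le (by norm_num), ENNReal.ofReal_mul (by positivity)]
    ring

/-- Integrability at infinity of `d ^ (-a)` for `a` above the dimension. -/
lemma IsUpperRegular.lintegral_compl_ball_le (H : IsUpperRegular μ d K Q A) {a : ℝ} (ha : Q < a) :
    ∃ C : ℝ≥0∞, C ≠ ⊤ ∧ ∀ (y : X) (R : ℝ), 0 < R →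
      ∫⁻ x in {x | R ≤ d x y}, ENNReal.ofReal (d x y ^ (-a)) ∂μ ≤
        C * ENNReal.ofReal (R ^ (Q - a)) := by
  have hlt : (2 : ℝ) ^ (Q - a) < 1 :=
    Real.rpow_lt_one_of_one_lt_of_neg (by norm_num) (by linarith)
  obtain ⟨C, hC, h⟩ := H.lintegral_le_of_shells (by norm_num) hlt
  refine ⟨C, hC, fun y R hR => h y R _ hR (Filter.Eventually.of_forall fun x hxR => ?_)⟩
  obtain ⟨n, hn1, hn2⟩ := exists_nat_pow_near (x := d x y / R) (y := 2)
    (by rw [one_le_div hR]; exact hxR) (by norm_num)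
  rw [le_div_iff₀ hR] at hn1
  rw [div_lt_iff₀ hR, pow_succ] at hn2
  exact ⟨n, by linarith, by linarith⟩

end UpperRegular

/-! ### The region of comparable weights -/

section OneSided

variable {X : Type*} [MeasurableSpace X] {μ : Measure X} {d : X → X → ℝ} {K Q A : ℝ}

lemma le_ofReal_rpow_inv_of_rpow_le {a : ℝ≥0∞} {r s : ℝ} (hr : 0 < r) (hs : 0 < s)
    (h : a ^ r ≤ ENNReal.ofReal s) : a ≤ ENNReal.ofReal (s ^ r⁻¹) := by
  rw [← ENNReal.ofReal_rpow_of_pos hs]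
  exact (ENNReal.le_rpow_inv_iff hr).2 h

/-- One half of the Hardy–Littlewood–Sobolev inequality: for fixed `y`, the part of the integral
where `h ^ r` is at most a level `s`. Inside the ball of measure about `s⁻¹` the function `h` is
bounded by `s ^ (1 / r)`; outside it Hölder's inequality applies. -/
lemma IsUpperRegular.lintegral_riesz_sublevel_le (H : IsUpperRegular μ d K Q A) {p r γ : ℝ}
    (hp : 1 < p) (hr : 1 < r) (hpr : 1 < p⁻¹ + r⁻¹) (hγ : p⁻¹ + r⁻¹ + γ / Q = 2) :
    ∃ C : ℝ≥0∞, C ≠ ⊤ ∧ ∀ h : X → ℝ≥0∞, Measurable h → ∫⁻ x, h x ^ r ∂μ ≤ 1 →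
      ∀ (y : X) (s : ℝ), 0 < s →
        ∫⁻ x in {x | h x ^ r ≤ ENNReal.ofReal s}, ENNReal.ofReal (d x y ^ (-γ)) * h x ∂μ ≤
          C * ENNReal.ofReal (s ^ (1 - p⁻¹)) := by
  have hQ := H.dim_pos
  have hr0 : 0 < r := by linarith
  obtain ⟨r', hrr⟩ : ∃ r', r.HolderConjugate r' := ⟨_, Real.HolderConjugate.conjExponent hr⟩
  have hr'0 : 0 < r' := hrr.symm.pos
  have hr' : r'⁻¹ = 1 - r⁻¹ := hrr.one_sub_inv.symm
  have hγ' : γ = Q * (2 - p⁻¹ - r⁻¹) := by field_simp at hγ ⊢; linarith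
  have hγQ : γ < Q := by rw [hγ']; nlinarith
  have hγr : Q < γ * r' := by
    have h1 : Q * r'⁻¹ < γ := by
      rw [hγ', hr']
      have := inv_lt_one_of_one_lt₀ hp
      exact mul_lt_mul_of_pos_left (by linarith) hQ
    calc Q = Q * r'⁻¹ * r' := by field_simp
      _ < γ * r' := by gcongr
  obtain ⟨C₁, hC₁, h₁⟩ := H.lintegral_ball_le hγQ
  obtain ⟨C₂, hC₂, h₂⟩ := H.lintegral_compl_ball_le hγr
  refine ⟨C₁ + C₂ ^ r'⁻¹, ENNReal.add_ne_top.2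
    ⟨hC₁, ENNReal.rpow_ne_top_of_nonneg (by positivity) hC₂⟩, fun h hm hh y s hs => ?_⟩
  have hd := H.measurable_left y
  set R : ℝ := s ^ (-Q⁻¹) with hR
  have hR0 : 0 < R := by positivity
  have near : ∫⁻ x in {x | h x ^ r ≤ ENNReal.ofReal s} ∩ {x | d x y ≤ R},
      ENNReal.ofReal (d x y ^ (-γ)) * h x ∂μ ≤ C₁ * ENNReal.ofReal (s ^ (1 - p⁻¹)) := by
    calc _ ≤ ∫⁻ x in {x | h x ^ r ≤ ENNReal.ofReal s} ∩ {x | d x y ≤ R},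
          ENNReal.ofReal (d x y ^ (-γ)) * ENNReal.ofReal (s ^ r⁻¹) ∂μ := by
          refine setLIntegral_mono (by fun_prop) fun x hx => ?_
          gcongr
          exact le_ofReal_rpow_inv_of_rpow_le hr0 hs hx.1
      _ ≤ ∫⁻ x in {x | d x y ≤ R},
          ENNReal.ofReal (d x y ^ (-γ)) * ENNReal.ofReal (s ^ r⁻¹) ∂μ :=
          lintegral_mono_set Set.inter_subset_right
      _ ≤ C₁ * ENNReal.ofReal (R ^ (Q - γ)) * ENNReal.ofReal (s ^ r⁻¹) := by
          rw [lintegral_mul_const _ (by fun_prop)]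
          gcongr
          exact h₁ y R hR0
      _ = C₁ * ENNReal.ofReal (s ^ (1 - p⁻¹)) := by
          rw [mul_assoc, ← ENNReal.ofReal_mul (by positivity), hR, ← Real.rpow_mul hs.le,
            ← Real.rpow_add hs]
          congr 3
          rw [hγ']; field_simp; ring
  have far : ∫⁻ x in {x | R ≤ d x y}, ENNReal.ofReal (d x y ^ (-γ)) * h x ∂μ ≤
      C₂ ^ r'⁻¹ * ENNReal.ofReal (s ^ (1 - p⁻¹)) := by
    calc _ ≤ (∫⁻ x in {x | R ≤ d x y}, ENNReal.ofReal (d x y ^ (-γ)) ^ r' ∂μ) ^ (1 / r') *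
          (∫⁻ x in {x | R ≤ d x y}, h x ^ r ∂μ) ^ (1 / r) :=
          ENNReal.lintegral_mul_le_Lp_mul_Lq _ hrr.symm (by fun_prop) hm.aemeasurable
      _ ≤ (C₂ * ENNReal.ofReal (R ^ (Q - γ * r'))) ^ r'⁻¹ * 1 := by
          rw [one_div, one_div]
          gcongr
          · refine le_trans (le_of_eq ?_) (h₂ y R hR0)
            refine setLIntegral_congr_fun (hd measurableSet_Ici) fun x hx => ?_
            rw [ENNReal.ofReal_rpow_of_nonneg (by have := H.nonneg x y; positivity) hr'0.le,
              ← Real.rpow_mul (H.nonneg x y), neg_mul]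
          · refine ENNReal.rpow_le_one ((setLIntegral_le_lintegral _ _).trans hh) (by positivity)
      _ = C₂ ^ r'⁻¹ * ENNReal.ofReal (s ^ (1 - p⁻¹)) := by
          rw [mul_one, ENNReal.mul_rpow_of_nonneg _ _ (by positivity),
            ENNReal.ofReal_rpow_of_nonneg (by positivity) (by positivity), hR,
            ← Real.rpow_mul hs.le, ← Real.rpow_mul hs.le]
          congr 3
          have : Q * r'⁻¹ = Q * (1 - r⁻¹) := by rw [hr']
          rw [mul_assoc, sub_mul, mul_assoc γ, mul_inv_cancel₀ hr'0.ne', this, hγ']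
          field_simp; ring
  calc _ ≤ ∫⁻ x in ({x | h x ^ r ≤ ENNReal.ofReal s} ∩ {x | d x y ≤ R}) ∪ {x | R ≤ d x y},
        ENNReal.ofReal (d x y ^ (-γ)) * h x ∂μ := by
        refine lintegral_mono_set fun x hx => ?_
        rcases le_total (d x y) R with h' | h'
        exacts [Or.inl ⟨hx, h'⟩, Or.inr h']
    _ ≤ _ := lintegral_union_le _ _ _
    _ ≤ _ := by rw [add_mul]; exact add_le_add near far

/-- The Stein–Weiss kernel on a quasi-metric space with base point `o`; the weight of exponent `α`
belongs to the integration variable `y`. The powers are those of `Real.rpow`, whose values at zero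
play no role since points at distance zero form a null set. -/
noncomputable def kernel (d : X → X → ℝ) (o : X) (α β l : ℝ) (x y : X) : ℝ :=
  d x o ^ (-β) * d x y ^ (-l) * d y o ^ (-α)

lemma IsUpperRegular.kernel_nonneg (H : IsUpperRegular μ d K Q A) (o : X) (α β l : ℝ) (x y : X) :
    0 ≤ kernel d o α β l x y := by
  have h1 := H.nonneg x o
  have h2 := H.nonneg x y
  have h3 := H.nonneg y o
  unfold kernel
  positivity

/-- Exchanging the two variables exchanges the two weights. -/
lemma IsUpperRegular.kernel_swap (H : IsUpperRegular μ d K Q A) (o : X) (α β l : ℝ) (x y : X) :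
    kernel d o β α l y x = kernel d o α β l x y := by
  unfold kernel
  rw [H.symm y x]
  ring

lemma IsUpperRegular.measurable_kernel (H : IsUpperRegular μ d K Q A) (o : X) (α β l : ℝ) :
    Measurable fun z : X × X => kernel d o α β l z.1 z.2 := by
  have h1 : Measurable fun z : X × X => d z.1 o := (H.measurable_left o).comp measurable_fst
  have h2 : Measurable fun z : X × X => d z.2 o := (H.measurable_left o).comp measurable_snd
  have h3 := H.measurable
  unfold kernel
  fun_prop

lemma rpow_neg_le_of_comparable {K s t a : ℝ} (hK : 1 ≤ K) (hs : 0 < s) (ht : 0 < t)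
    (hst : s ≤ K * t) (hts : t ≤ K * s) : s ^ (-a) ≤ K ^ |a| * t ^ (-a) := by
  have hK0 : 0 < K := by linarith
  rcases le_total 0 a with ha | ha
  · rw [abs_of_nonneg ha]
    calc s ^ (-a) ≤ (K⁻¹ * t) ^ (-a) :=
          Real.rpow_le_rpow_of_nonpos (by positivity) (by rw [inv_mul_le_iff₀ hK0]; exact hts)
            (by linarith)
      _ = K ^ a * t ^ (-a) := by
          rw [Real.mul_rpow (by positivity) ht.le, Real.inv_rpow hK0.le, Real.rpow_neg hK0.le,
            inv_inv]
  · rw [abs_of_nonpos ha]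
    calc s ^ (-a) ≤ (K * t) ^ (-a) := Real.rpow_le_rpow hs.le hst (by linarith)
      _ = K ^ (-a) * t ^ (-a) := Real.mul_rpow hK0.le ht.le

/-- Where `d x o` and `d y o` are comparable, the two weights merge into one power of `d y o`. -/
lemma IsUpperRegular.kernel_le_of_comparable (H : IsUpperRegular μ d K Q A) {o : X} {α β l : ℝ}
    {x y : X} (hx : 0 < d x o) (hy : 0 < d y o) (hxy : d x o ≤ K * d y o)
    (hyx : d y o ≤ K * d x o) :
    kernel d o α β l x y ≤ K ^ |β| * (d y o ^ (-(α + β)) * d x y ^ (-l)) := by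
  have h2 := H.nonneg x y
  calc kernel d o α β l x y ≤ (K ^ |β| * d y o ^ (-β)) * d x y ^ (-l) * d y o ^ (-α) := by
        unfold kernel
        gcongr
        exact rpow_neg_le_of_comparable H.one_le hx hy hxy hyx
    _ = _ := by
        rw [neg_add, Real.rpow_add hy]; ring

lemma IsUpperRegular.dist_le_of_comparable (H : IsUpperRegular μ d K Q A) {o x y : X}
    (hxy : d x o ≤ K * d y o) : d x y ≤ K ^ 2 * d y o := by
  have hK := H.one_le
  have h0 := H.nonneg y o
  calc d x y ≤ K * max (d x o) (d o y) := H.triangle x o y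
    _ ≤ K * (K * d y o) := by
        gcongr
        refine max_le hxy ?_
        rw [H.symm o y]
        nlinarith
    _ = _ := by ring

/-- The estimate of the comparable region for fixed `y`, at heights of `h ^ r` up to `s`. If
`1 < 1 / p + 1 / r`, the kernel is dominated by the Riesz kernel of order `α + β + l < Q`. If
`1 / p + 1 / r = 1`, then `α + β + l = Q`, and `d y o ^ (-(α + β)) * d x y ^ (-l)` has bounded
integral over `d x y ≤ K ^ 2 * d y o`. -/
lemma IsUpperRegular.lintegral_comparable_sublevel_le (H : IsUpperRegular μ d K Q A) (o : X)
    {p r α β l : ℝ} (hp : 1 < p) (hr : 1 < r) (hpr : 1 ≤ p⁻¹ + r⁻¹) (hlQ : l < Q)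
    (hαβ : 0 ≤ α + β) (hscale : p⁻¹ + r⁻¹ + (α + β + l) / Q = 2) :
    ∃ C : ℝ≥0∞, C ≠ ⊤ ∧ ∀ h : X → ℝ≥0∞, Measurable h → ∫⁻ x, h x ^ r ∂μ ≤ 1 →
      ∀ (y : X) (s : ℝ), 0 < d y o → 0 < s →
        ∫⁻ x in {x | (d x o ≤ K * d y o ∧ d y o ≤ K * d x o) ∧ h x ^ r ≤ ENNReal.ofReal s},
          ENNReal.ofReal (kernel d o α β l x y) * h x ∂μ ≤
          C * ENNReal.ofReal (s ^ (1 - p⁻¹)) := by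
  have hQ := H.dim_pos
  have hK := H.one_le
  have hK0 : 0 < K := by linarith
  have hms : ∀ (h : X → ℝ≥0∞) (y : X) (s : ℝ), Measurable h → MeasurableSet
      {x | (d x o ≤ K * d y o ∧ d y o ≤ K * d x o) ∧ h x ^ r ≤ ENNReal.ofReal s} := by
    intro h y s hm
    have := H.measurable_left o
    exact ((measurableSet_le this measurable_const).inter
      (measurableSet_le measurable_const (this.const_mul K))).inter
      (measurableSet_le (hm.pow_const r) measurable_const)
  rcases hpr.lt_or_eq with hpr | hpr
  · obtain ⟨C, hC, key⟩ := H.lintegral_riesz_sublevel_le hp hr hpr hscale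
    refine ⟨ENNReal.ofReal (K ^ |β| * (K ^ 2) ^ (α + β)) * C,
      ENNReal.mul_ne_top ENNReal.ofReal_ne_top hC, fun h hm hh y s hy hs => ?_⟩
    have hd := H.measurable_left y
    calc _ ≤ ∫⁻ x in {x | (d x o ≤ K * d y o ∧ d y o ≤ K * d x o) ∧ h x ^ r ≤ ENNReal.ofReal s},
          ENNReal.ofReal (K ^ |β| * (K ^ 2) ^ (α + β)) *
            (ENNReal.ofReal (d x y ^ (-(α + β + l))) * h x) ∂μ := by
          refine setLIntegral_mono_ae' (hms h y s hm) ?_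
          filter_upwards [H.ae_dist_pos o, H.ae_dist_pos y] with x hxo hxy hx
          have hw : d y o ^ (-(α + β)) ≤ (K ^ 2) ^ (α + β) * d x y ^ (-(α + β)) := by
            rw [Real.rpow_neg hy.le, Real.rpow_neg hxy.le, ← div_eq_mul_inv, inv_eq_one_div,
              div_le_div_iff₀ (by positivity) (by positivity), one_mul,
              ← Real.mul_rpow (by positivity) hy.le]
            exact Real.rpow_le_rpow hxy.le (H.dist_le_of_comparable hx.1.1) hαβ
          rw [← mul_assoc, ← ENNReal.ofReal_mul (by positivity)]
          gcongr
          calc _ ≤ K ^ |β| * (d y o ^ (-(α + β)) * d x y ^ (-l)) :=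
                H.kernel_le_of_comparable hxo hy hx.1.1 hx.1.2
            _ ≤ K ^ |β| * ((K ^ 2) ^ (α + β) * d x y ^ (-(α + β)) * d x y ^ (-l)) := by gcongr
            _ = _ := by rw [neg_add (α + β), Real.rpow_add hxy]; ring
      _ ≤ ENNReal.ofReal (K ^ |β| * (K ^ 2) ^ (α + β)) *
          ∫⁻ x in {x | h x ^ r ≤ ENNReal.ofReal s},
            ENNReal.ofReal (d x y ^ (-(α + β + l))) * h x ∂μ := by
          rw [lintegral_const_mul _ (by fun_prop)]
          gcongr
          exact And.right
      _ ≤ _ := by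
          rw [mul_assoc]
          gcongr
          exact key h hm hh y s hs
  · obtain ⟨C, hC, key⟩ := H.lintegral_ball_le hlQ
    refine ⟨ENNReal.ofReal (K ^ |β| * (K ^ 2) ^ (Q - l)) * C,
      ENNReal.mul_ne_top ENNReal.ofReal_ne_top hC, fun h hm hh y s hy hs => ?_⟩
    have hd := H.measurable_left y
    have hsum : α + β = Q - l := by
      rw [← hpr] at hscale
      field_simp at hscale
      linarith
    calc _ ≤ ∫⁻ x in {x | (d x o ≤ K * d y o ∧ d y o ≤ K * d x o) ∧ h x ^ r ≤ ENNReal.ofReal s},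
          ENNReal.ofReal (K ^ |β| * d y o ^ (-(α + β)) * s ^ r⁻¹) *
            ENNReal.ofReal (d x y ^ (-l)) ∂μ := by
          refine setLIntegral_mono_ae' (hms h y s hm) ?_
          filter_upwards [H.ae_dist_pos o] with x hxo hx
          calc _ ≤ ENNReal.ofReal (K ^ |β| * (d y o ^ (-(α + β)) * d x y ^ (-l))) *
                ENNReal.ofReal (s ^ r⁻¹) := by
                gcongr
                · exact H.kernel_le_of_comparable hxo hy hx.1.1 hx.1.2
                · exact le_ofReal_rpow_inv_of_rpow_le (by linarith) hs hx.2
            _ = _ := by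
                have := H.nonneg x y
                rw [← ENNReal.ofReal_mul (by positivity), ← ENNReal.ofReal_mul (by positivity)]
                congr 1
                ring
      _ ≤ ENNReal.ofReal (K ^ |β| * d y o ^ (-(α + β)) * s ^ r⁻¹) *
          ∫⁻ x in {x | d x y ≤ K ^ 2 * d y o}, ENNReal.ofReal (d x y ^ (-l)) ∂μ := by
          rw [lintegral_const_mul _ (by fun_prop)]
          gcongr
          exact fun hx => H.dist_le_of_comparable hx.1.1
      _ ≤ ENNReal.ofReal (K ^ |β| * d y o ^ (-(α + β)) * s ^ r⁻¹) *
          (C * ENNReal.ofReal ((K ^ 2 * d y o) ^ (Q - l))) := by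
          gcongr
          exact key y _ (by positivity)
      _ = _ := by
          rw [mul_left_comm, ← ENNReal.ofReal_mul (by positivity), mul_comm _ C,
            mul_assoc C, ← ENNReal.ofReal_mul (by positivity)]
          congr 2
          have : r⁻¹ = 1 - p⁻¹ := by linarith
          have h1 : d y o ^ (-(α + β)) * d y o ^ (Q - l) = 1 := by
            rw [← Real.rpow_add hy, hsum, neg_add_cancel, Real.rpow_zero]
          rw [this, Real.mul_rpow (by positivity) hy.le]
          linear_combination K ^ |β| * s ^ (1 - p⁻¹) * (K ^ 2) ^ (Q - l) * h1

/-- Integrating the estimate for fixed `y` over `y`: on the part of the comparable region where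
`h x ^ r ≤ f y ^ p`, the level `s = f y ^ p` gives `f y * (f y ^ p) ^ (1 - 1 / p) = f y ^ p`. -/
lemma IsUpperRegular.lintegral_comparable_le (H : IsUpperRegular μ d K Q A) (o : X)
    {p r α β l : ℝ} (hp : 1 < p) (hr : 1 < r) (hpr : 1 ≤ p⁻¹ + r⁻¹) (hlQ : l < Q)
    (hαβ : 0 ≤ α + β) (hscale : p⁻¹ + r⁻¹ + (α + β + l) / Q = 2) :
    ∃ C : ℝ≥0∞, C ≠ ⊤ ∧ ∀ f h : X → ℝ≥0∞, Measurable f → Measurable h →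
      ∫⁻ x, f x ^ p ∂μ ≤ 1 → ∫⁻ x, h x ^ r ∂μ ≤ 1 →
        ∫⁻ y, ∫⁻ x in {x | (d x o ≤ K * d y o ∧ d y o ≤ K * d x o) ∧ h x ^ r ≤ f y ^ p},
          ENNReal.ofReal (kernel d o α β l x y) * (f y * h x) ∂μ ∂μ ≤ C := by
  obtain ⟨C, hC, key⟩ := H.lintegral_comparable_sublevel_le o hp hr hpr hlQ hαβ hscale
  refine ⟨C, hC, fun f h hf hm hF hH => ?_⟩
  have hp0 : 0 < p := by linarith
  have hfin : ∀ᵐ y ∂μ, f y ^ p < ⊤ :=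
    ae_lt_top (by fun_prop) (hF.trans_lt ENNReal.one_lt_top).ne
  calc _ ≤ ∫⁻ y, C * f y ^ p ∂μ := by
        refine lintegral_mono_ae ?_
        filter_upwards [hfin, H.ae_dist_pos o] with y hy hyo
        have hfy : f y ≠ ⊤ := fun h => by simp [h, hp0] at hy
        rcases eq_or_ne (f y) 0 with h0 | h0
        · simp [h0]
        have hs0 : 0 < (f y ^ p).toReal :=
          ENNReal.toReal_pos (by simp [h0, hfy]) hy.ne
        have hs : ENNReal.ofReal (f y ^ p).toReal = f y ^ p := ENNReal.ofReal_toReal hy.ne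
        have := key h hm hH y _ hyo hs0
        rw [← ENNReal.ofReal_rpow_of_pos hs0, hs] at this
        calc _ = f y * ∫⁻ x in
              {x | (d x o ≤ K * d y o ∧ d y o ≤ K * d x o) ∧ h x ^ r ≤ f y ^ p},
              ENNReal.ofReal (kernel d o α β l x y) * h x ∂μ := by
              rw [← lintegral_const_mul' _ _ hfy]
              refine lintegral_congr fun x => ?_
              ring
          _ ≤ f y * (C * (f y ^ p) ^ (1 - p⁻¹)) := by gcongr
          _ = C * f y ^ p := by
              rw [mul_left_comm, ← ENNReal.rpow_mul]
              congr 1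
              nth_rewrite 1 [← ENNReal.rpow_one (f y)]
              rw [← ENNReal.rpow_add _ _ h0 hfy]
              congr 1
              field_simp
              ring
    _ ≤ C * 1 := by
        rw [lintegral_const_mul _ (by fun_prop)]
        gcongr
    _ = C := mul_one C

end OneSided

/-! ### Hardy's inequality -/

section Hardy

variable {X : Type*} [MeasurableSpace X] {μ : Measure X} {d : X → X → ℝ} {K Q A : ℝ}

/-- Hölder's inequality with the auxiliary weight `d y o ^ δ`; any `δ` with
`α + δ < Q / p'` is admissible. -/
lemma IsUpperRegular.lintegral_weight_mul_le (H : IsUpperRegular μ d K Q A) (o : X)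
    {p p' α δ : ℝ} (hpp : p.HolderConjugate p') (hδ : α + δ < Q / p') :
    ∃ C : ℝ≥0∞, C ≠ ⊤ ∧ ∀ f : X → ℝ≥0∞, Measurable f → ∀ R : ℝ, 0 < R →
      ∫⁻ y in {y | d y o ≤ R}, ENNReal.ofReal (d y o ^ (-α)) * f y ∂μ ≤
        C * ENNReal.ofReal (R ^ (Q / p' - (α + δ))) *
          (∫⁻ y in {y | d y o ≤ R}, ENNReal.ofReal (d y o ^ (δ * p)) * f y ^ p ∂μ) ^ p⁻¹ := by
  have hp0 := hpp.pos
  have hp'0 := hpp.symm.pos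
  have hd := H.measurable_left o
  have ha : (α + δ) * p' < Q := by rwa [lt_div_iff₀ hp'0] at hδ
  obtain ⟨C, hC, key⟩ := H.lintegral_ball_le ha
  refine ⟨C ^ p'⁻¹, ENNReal.rpow_ne_top_of_nonneg (by positivity) hC, fun f hf R hR => ?_⟩
  have hS : MeasurableSet {y | d y o ≤ R} := hd measurableSet_Iic
  calc _ = ∫⁻ y in {y | d y o ≤ R},
        ENNReal.ofReal (d y o ^ (-(α + δ))) * (ENNReal.ofReal (d y o ^ δ) * f y) ∂μ := by
        refine setLIntegral_congr_fun_ae hS ?_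
        filter_upwards [H.ae_dist_pos o] with y hy _
        rw [← mul_assoc, ← ENNReal.ofReal_mul (by positivity), ← Real.rpow_add hy]
        congr 3
        ring
    _ ≤ (∫⁻ y in {y | d y o ≤ R}, ENNReal.ofReal (d y o ^ (-(α + δ))) ^ p' ∂μ) ^ (1 / p') *
        (∫⁻ y in {y | d y o ≤ R}, (ENNReal.ofReal (d y o ^ δ) * f y) ^ p ∂μ) ^ (1 / p) :=
        ENNReal.lintegral_mul_le_Lp_mul_Lq _ hpp.symm (by fun_prop) (by fun_prop)
    _ = (∫⁻ y in {y | d y o ≤ R}, ENNReal.ofReal (d y o ^ (-((α + δ) * p'))) ∂μ) ^ p'⁻¹ *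
        (∫⁻ y in {y | d y o ≤ R}, ENNReal.ofReal (d y o ^ (δ * p)) * f y ^ p ∂μ) ^ p⁻¹ := by
        rw [one_div, one_div]
        congr 2
        · refine lintegral_congr fun y => ?_
          rw [ENNReal.ofReal_rpow_of_nonneg (Real.rpow_nonneg (H.nonneg y o) _) hp'0.le,
            ← Real.rpow_mul (H.nonneg y o), neg_mul]
        · refine lintegral_congr fun y => ?_
          rw [ENNReal.mul_rpow_of_nonneg _ _ hp0.le,
            ENNReal.ofReal_rpow_of_nonneg (Real.rpow_nonneg (H.nonneg y o) _) hp0.le,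
            ← Real.rpow_mul (H.nonneg y o)]
    _ ≤ (C * ENNReal.ofReal (R ^ (Q - (α + δ) * p'))) ^ p'⁻¹ *
        (∫⁻ y in {y | d y o ≤ R}, ENNReal.ofReal (d y o ^ (δ * p)) * f y ^ p ∂μ) ^ p⁻¹ := by
        gcongr
        exact key o R hR
    _ = _ := by
        rw [ENNReal.mul_rpow_of_nonneg _ _ (by positivity),
          ENNReal.ofReal_rpow_of_nonneg (by positivity) (by positivity), ← Real.rpow_mul hR.le]
        congr 4
        field_simp

lemma mul_le_rpow_add_rpow (a b : ℝ≥0∞) {p q : ℝ} (hpq : p.HolderConjugate q) :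
    a * b ≤ a ^ p + b ^ q := by
  refine (ENNReal.young_inequality a b hpq).trans (add_le_add ?_ ?_) <;>
    refine ENNReal.div_le_of_le_mul (le_mul_of_one_le_right' ?_)
  · simpa using hpq.lt.le
  · simpa using hpq.symm.lt.le

/-- Hardy's inequality in bilinear form, for `f` and `h` of norm at most one. With
`G x = ∫ d y o ^ (δ p) f y ^ p` over `d y o ≤ d x o`, the inner integral is controlled by
`G x ^ (1 / p)`; the trivial bound `G x ≤ d x o ^ (δ p)` turns `G x ^ (q / p)` into a multiple of
`G x`, and the remaining double integral is computed by Tonelli's theorem. -/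
lemma IsUpperRegular.lintegral_hardy_le [SFinite μ] (H : IsUpperRegular μ d K Q A) (o : X)
    {p p' q r α b : ℝ} (hpp : p.HolderConjugate p') (hqr : q.HolderConjugate r) (hpq : p ≤ q)
    (hα : α < Q / p') (hb : α + b = Q / p' + Q / q) :
    ∃ C : ℝ≥0∞, C ≠ ⊤ ∧ ∀ f h : X → ℝ≥0∞, Measurable f → Measurable h →
      ∫⁻ x, f x ^ p ∂μ ≤ 1 → ∫⁻ x, h x ^ r ∂μ ≤ 1 →
        ∫⁻ x, ∫⁻ y in {y | d y o ≤ d x o},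
          ENNReal.ofReal (d x o ^ (-b) * d y o ^ (-α)) * (f y * h x) ∂μ ∂μ ≤ C := by
  have hp0 := hpp.pos
  have hq0 := hqr.pos
  have hd := H.measurable_left o
  obtain ⟨δ, hδ0, hδ⟩ : ∃ δ > 0, α + δ < Q / p' :=
    ⟨(Q / p' - α) / 2, by linarith, by linarith⟩
  obtain ⟨C₁, hC₁, h₁⟩ := H.lintegral_weight_mul_le o hpp hδ
  obtain ⟨C₂, hC₂, h₂⟩ := H.lintegral_compl_ball_le (a := Q + δ * p)
    (lt_add_of_pos_right Q (by positivity))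
  refine ⟨C₁ * (1 + C₂), ENNReal.mul_ne_top hC₁ (ENNReal.add_ne_top.2 ⟨by simp, hC₂⟩),
    fun f h hf hh hF hH => ?_⟩
  set G : X → ℝ≥0∞ := fun x =>
    ∫⁻ y in {y | d y o ≤ d x o}, ENNReal.ofReal (d y o ^ (δ * p)) * f y ^ p ∂μ with hG
  have hE : MeasurableSet {z : X × X | d z.2 o ≤ d z.1 o} :=
    measurableSet_le (hd.comp measurable_snd) (hd.comp measurable_fst)
  have hS : ∀ x, MeasurableSet {y | d y o ≤ d x o} := fun x => hd measurableSet_Iic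
  have hS' : ∀ y, MeasurableSet {x | d y o ≤ d x o} := fun x => hd measurableSet_Ici
  have hGle : ∀ x, G x ≤ ENNReal.ofReal (d x o ^ (δ * p)) := fun x => by
    calc G x ≤ ∫⁻ y in {y | d y o ≤ d x o}, ENNReal.ofReal (d x o ^ (δ * p)) * f y ^ p ∂μ := by
          refine setLIntegral_mono (by fun_prop) fun y hy => ?_
          gcongr
          · exact H.nonneg y o
          · exact hy
      _ ≤ ∫⁻ y, ENNReal.ofReal (d x o ^ (δ * p)) * f y ^ p ∂μ := setLIntegral_le_lintegral _ _
      _ ≤ ENNReal.ofReal (d x o ^ (δ * p)) * 1 := by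
          rw [lintegral_const_mul _ (by fun_prop)]
          gcongr
      _ = _ := mul_one _
  -- The product over the region `d y o ≤ d x o`, written with an indicator for Tonelli's theorem.
  set Φ : X → X → ℝ≥0∞ := fun x y => {z : X × X | d z.2 o ≤ d z.1 o}.indicator
    (fun z => ENNReal.ofReal (d z.1 o ^ (-(Q + δ * p))) *
      (ENNReal.ofReal (d z.2 o ^ (δ * p)) * f z.2 ^ p)) (x, y) with hΦ
  have hΦm : Measurable (Function.uncurry Φ) := by
    have h1 : Measurable fun z : X × X => d z.1 o := hd.comp measurable_fst
    have h2 : Measurable fun z : X × X => d z.2 o := hd.comp measurable_snd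
    exact Measurable.indicator (by fun_prop) hE
  have tonelli : ∫⁻ x, ENNReal.ofReal (d x o ^ (-(Q + δ * p))) * G x ∂μ ≤ C₂ := by
    calc _ = ∫⁻ x, ∫⁻ y, Φ x y ∂μ ∂μ := by
          refine lintegral_congr fun x => ?_
          rw [hG, ← lintegral_const_mul _ (by fun_prop), ← lintegral_indicator (hS x)]
          rfl
      _ = ∫⁻ y, ∫⁻ x, Φ x y ∂μ ∂μ := lintegral_lintegral_swap hΦm.aemeasurable
      _ ≤ ∫⁻ y, C₂ * f y ^ p ∂μ := by
          refine lintegral_mono_ae ?_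
          filter_upwards [H.ae_dist_pos o] with y hy
          calc ∫⁻ x, Φ x y ∂μ = ∫⁻ x in {x | d y o ≤ d x o},
                ENNReal.ofReal (d x o ^ (-(Q + δ * p))) *
                  (ENNReal.ofReal (d y o ^ (δ * p)) * f y ^ p) ∂μ := by
                rw [← lintegral_indicator (hS' y)]
                rfl
            _ ≤ C₂ * ENNReal.ofReal (d y o ^ (Q - (Q + δ * p))) *
                  (ENNReal.ofReal (d y o ^ (δ * p)) * f y ^ p) := by
                rw [lintegral_mul_const _ (by fun_prop)]
                gcongr
                exact h₂ o _ hy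
            _ = C₂ * f y ^ p := by
                rw [mul_assoc C₂, ← mul_assoc (ENNReal.ofReal _),
                  ← ENNReal.ofReal_mul (by positivity), ← Real.rpow_add hy]
                simp
      _ ≤ C₂ * 1 := by
          rw [lintegral_const_mul _ (by fun_prop)]
          gcongr
      _ = C₂ := mul_one _
  calc _ ≤ ∫⁻ x, C₁ * (h x ^ r + ENNReal.ofReal (d x o ^ (-(Q + δ * p))) * G x) ∂μ := by
        refine lintegral_mono_ae ?_
        filter_upwards [H.ae_dist_pos o] with x hx
        calc _ = ENNReal.ofReal (d x o ^ (-b)) * h x *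
              ∫⁻ y in {y | d y o ≤ d x o}, ENNReal.ofReal (d y o ^ (-α)) * f y ∂μ := by
              rw [← lintegral_const_mul _ (by fun_prop)]
              refine lintegral_congr fun y => ?_
              rw [ENNReal.ofReal_mul (by positivity)]
              ring
          _ ≤ ENNReal.ofReal (d x o ^ (-b)) * h x *
              (C₁ * ENNReal.ofReal (d x o ^ (Q / p' - (α + δ))) * G x ^ p⁻¹) := by
              gcongr
              exact h₁ f hf _ hx
          _ = C₁ * (h x * (ENNReal.ofReal (d x o ^ (-(Q / q) - δ)) * G x ^ p⁻¹)) := by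
              have : ENNReal.ofReal (d x o ^ (-b)) * ENNReal.ofReal (d x o ^ (Q / p' - (α + δ))) =
                  ENNReal.ofReal (d x o ^ (-(Q / q) - δ)) := by
                rw [← ENNReal.ofReal_mul (by positivity), ← Real.rpow_add hx]
                congr 2
                linarith
              rw [← this]
              ring
          _ ≤ C₁ * (h x ^ r + (ENNReal.ofReal (d x o ^ (-(Q / q) - δ)) * G x ^ p⁻¹) ^ q) := by
              gcongr
              exact mul_le_rpow_add_rpow _ _ hqr.symm
          _ ≤ C₁ * (h x ^ r + ENNReal.ofReal (d x o ^ (-(Q + δ * p))) * G x) := by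
              gcongr
              rw [ENNReal.mul_rpow_of_nonneg _ _ hq0.le,
                ENNReal.ofReal_rpow_of_nonneg (by positivity) hq0.le, ← Real.rpow_mul hx.le,
                ← ENNReal.rpow_mul]
              have he : p⁻¹ * q = 1 + (p⁻¹ * q - 1) := by ring
              have hnn : 0 ≤ p⁻¹ * q - 1 := by
                rw [sub_nonneg, ← div_eq_inv_mul, one_le_div hp0]; exact hpq
              rw [he, ENNReal.rpow_add_of_nonneg _ _ zero_le_one hnn, ENNReal.rpow_one]
              calc _ ≤ ENNReal.ofReal (d x o ^ ((-(Q / q) - δ) * q)) *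
                    (G x * ENNReal.ofReal (d x o ^ (δ * p)) ^ (p⁻¹ * q - 1)) := by
                    gcongr
                    exact hGle x
                _ = _ := by
                    rw [ENNReal.ofReal_rpow_of_nonneg (by positivity) hnn, ← Real.rpow_mul hx.le,
                      mul_comm (G x), ← mul_assoc, ← ENNReal.ofReal_mul (by positivity),
                      ← Real.rpow_add hx]
                    congr 3
                    field_simp
                    ring
    _ ≤ C₁ * (1 + C₂) := by
        rw [lintegral_const_mul' _ _ hC₁, lintegral_add_left (by fun_prop)]
        gcongr

end Hardy

/-! ### The bilinear inequality for non-negative functions -/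

section Bilinear

variable {X : Type*} [MeasurableSpace X] {μ : Measure X} {d : X → X → ℝ} {K Q A : ℝ}

/-- Where `K * d y o < d x o`, the quasi-triangle inequality gives `d x o ≤ K * d x y`. -/
lemma IsUpperRegular.kernel_le_of_lt (H : IsUpperRegular μ d K Q A) {o : X} {α β l : ℝ}
    (hl : 0 ≤ l) {x y : X} (hxy : K * d y o < d x o) :
    kernel d o α β l x y ≤ K ^ l * (d x o ^ (-(β + l)) * d y o ^ (-α)) := by
  have hK := H.one_le
  have hK0 : 0 < K := by linarith
  have hy := H.nonneg y o
  have hx : 0 < d x o := lt_of_le_of_lt (by positivity) hxy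
  have hle : d x o ≤ K * d x y := by
    have := H.triangle x y o
    rcases le_total (d x y) (d y o) with h | h
    · rw [max_eq_right h] at this
      exact absurd this (not_le.2 hxy)
    · rwa [max_eq_left h] at this
  have hxy0 : 0 < d x y := by
    by_contra hneg
    have : d x y = 0 := le_antisymm (not_lt.1 hneg) (H.nonneg x y)
    rw [this, mul_zero] at hle
    linarith
  calc kernel d o α β l x y ≤ d x o ^ (-β) * (K ^ l * d x o ^ (-l)) * d y o ^ (-α) := by
        unfold kernel
        gcongr
        rw [Real.rpow_neg hx.le, Real.rpow_neg hxy0.le, ← div_eq_mul_inv, inv_eq_one_div,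
          div_le_div_iff₀ (by positivity) (by positivity), one_mul, ← Real.mul_rpow hK0.le hxy0.le]
        exact Real.rpow_le_rpow hx.le hle hl
    _ = _ := by
        rw [neg_add, Real.rpow_add hx]
        ring

/-- The contribution of the region where `x` is much farther from the base point than `y`. -/
lemma IsUpperRegular.lintegral_far_le [SFinite μ] (H : IsUpperRegular μ d K Q A) (o : X)
    {p p' q r α β l : ℝ} (hpp : p.HolderConjugate p') (hqr : q.HolderConjugate r) (hpq : p ≤ q)
    (hl : 0 ≤ l) (hα : α < Q / p') (hscale : α + β + l = Q / p' + Q / q) :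
    ∃ C : ℝ≥0∞, C ≠ ⊤ ∧ ∀ f h : X → ℝ≥0∞, Measurable f → Measurable h →
      ∫⁻ x, f x ^ p ∂μ ≤ 1 → ∫⁻ x, h x ^ r ∂μ ≤ 1 →
        ∫⁻ x, ∫⁻ y in {y | K * d y o < d x o},
          ENNReal.ofReal (kernel d o α β l x y) * (f y * h x) ∂μ ∂μ ≤ C := by
  obtain ⟨C, hC, key⟩ := H.lintegral_hardy_le o (b := β + l) hpp hqr hpq hα (by linarith)
  refine ⟨ENNReal.ofReal (K ^ l) * C, ENNReal.mul_ne_top ENNReal.ofReal_ne_top hC,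
    fun f h hf hh hF hH => ?_⟩
  have hK := H.one_le
  have hK0 : 0 < K := by linarith
  have hd := H.measurable_left o
  calc _ ≤ ∫⁻ x, ENNReal.ofReal (K ^ l) * ∫⁻ y in {y | d y o ≤ d x o},
          ENNReal.ofReal (d x o ^ (-(β + l)) * d y o ^ (-α)) * (f y * h x) ∂μ ∂μ := by
        refine lintegral_mono fun x => ?_
        rw [← lintegral_const_mul _ (by fun_prop)]
        calc _ ≤ ∫⁻ y in {y | K * d y o < d x o}, ENNReal.ofReal (K ^ l) *
              (ENNReal.ofReal (d x o ^ (-(β + l)) * d y o ^ (-α)) * (f y * h x)) ∂μ := by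
              refine setLIntegral_mono (by fun_prop) fun y hy => ?_
              rw [← mul_assoc (ENNReal.ofReal (K ^ l)), ← ENNReal.ofReal_mul (by positivity)]
              gcongr
              exact H.kernel_le_of_lt hl hy
          _ ≤ _ := by
              refine lintegral_mono_set fun y hy => ?_
              have h1 : K * d y o < d x o := hy
              have h2 := H.nonneg y o
              have : d y o ≤ d x o := by nlinarith
              exact this
    _ ≤ _ := by
        rw [lintegral_const_mul' _ _ ENNReal.ofReal_ne_top]
        gcongr
        exact key f h hf hh hF hH

lemma setLIntegral_prod_eq [SFinite μ] {E : Set (X × X)} (hE : MeasurableSet E)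
    {g : X × X → ℝ≥0∞} (hg : Measurable g) :
    ∫⁻ z in E, g z ∂(μ.prod μ) = ∫⁻ x, ∫⁻ y in {y | (x, y) ∈ E}, g (x, y) ∂μ ∂μ := by
  rw [← lintegral_indicator hE, lintegral_prod _ (hg.indicator hE).aemeasurable]
  refine lintegral_congr fun x => ?_
  have hS : MeasurableSet {y | (x, y) ∈ E} := measurable_prodMk_left hE
  rw [← lintegral_indicator hS]
  rfl

lemma setLIntegral_prod_symm_eq [SFinite μ] {E : Set (X × X)} (hE : MeasurableSet E)
    {g : X × X → ℝ≥0∞} (hg : Measurable g) :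
    ∫⁻ z in E, g z ∂(μ.prod μ) = ∫⁻ y, ∫⁻ x in {x | (x, y) ∈ E}, g (x, y) ∂μ ∂μ := by
  rw [← lintegral_indicator hE, lintegral_prod_symm' _ (hg.indicator hE)]
  refine lintegral_congr fun y => ?_
  have hS : MeasurableSet {x | (x, y) ∈ E} := measurable_prodMk_right hE
  rw [← lintegral_indicator hS]
  rfl

/-- The bilinear estimate for measurable functions of norm at most one. The regions `K |y| < |x|`
and `K |x| < |y|` are handled by Hardy's inequality, the comparable region by cutting along
`h x ^ r ≤ f y ^ p`; each estimate is used twice, with the roles of the variables exchanged. -/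
lemma IsUpperRegular.lintegral_kernel_le_of_norm_le_one [SFinite μ]
    (H : IsUpperRegular μ d K Q A) (o : X)
    {p p' q r α β l : ℝ} (hpp : p.HolderConjugate p') (hqr : q.HolderConjugate r) (hpq : p ≤ q)
    (hl : 0 ≤ l) (hlQ : l < Q) (hα : α < Q / p') (hβ : β < Q / q) (hαβ : 0 ≤ α + β)
    (hscale : α + β + l = Q / p' + Q / q) :
    ∃ C : ℝ≥0∞, C ≠ ⊤ ∧ ∀ f h : X → ℝ≥0∞, Measurable f → Measurable h →
      ∫⁻ x, f x ^ p ∂μ ≤ 1 → ∫⁻ x, h x ^ r ∂μ ≤ 1 →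
        ∫⁻ z, ENNReal.ofReal (kernel d o α β l z.1 z.2) * (f z.2 * h z.1) ∂(μ.prod μ) ≤ C := by
  have hQ := H.dim_pos
  have h1p : p⁻¹ = 1 - p'⁻¹ := hpp.symm.one_sub_inv.symm
  have h1r : r⁻¹ = 1 - q⁻¹ := hqr.one_sub_inv.symm
  have hrp : r ≤ p' := by
    have h1 : q⁻¹ ≤ p⁻¹ := inv_anti₀ hpp.pos hpq
    exact (inv_le_inv₀ hpp.symm.pos hqr.symm.pos).1 (by linarith)
  have hpr : 1 ≤ p⁻¹ + r⁻¹ := by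
    have h1 : q⁻¹ ≤ p⁻¹ := inv_anti₀ hpp.pos hpq
    linarith
  have hsc : p⁻¹ + r⁻¹ + (α + β + l) / Q = 2 := by
    rw [hscale, h1p, h1r]
    field_simp
    ring
  obtain ⟨C₁, hC₁, h₁⟩ := H.lintegral_far_le o (β := β) hpp hqr hpq hl hα hscale
  obtain ⟨C₂, hC₂, h₂⟩ := H.lintegral_far_le o (α := β) (β := α) (l := l)
    hqr.symm hpp.symm hrp hl hβ (by linarith)
  obtain ⟨C₃, hC₃, h₃⟩ := H.lintegral_comparable_le o hpp.lt hqr.symm.lt hpr hlQ hαβ hsc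
  obtain ⟨C₄, hC₄, h₄⟩ := H.lintegral_comparable_le o (α := β) (β := α) (l := l) hqr.symm.lt hpp.lt
    (by linarith) hlQ (by linarith) (by rw [← hsc]; ring)
  refine ⟨C₁ + C₂ + (C₃ + C₄), ENNReal.add_ne_top.2 ⟨ENNReal.add_ne_top.2 ⟨hC₁, hC₂⟩,
    ENNReal.add_ne_top.2 ⟨hC₃, hC₄⟩⟩, fun f h hf hh hF hH => ?_⟩
  have hd := H.measurable_left o
  have hm1 : Measurable fun z : X × X => d z.1 o := hd.comp measurable_fst
  have hm2 : Measurable fun z : X × X => d z.2 o := hd.comp measurable_snd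
  have hf2 : Measurable fun z : X × X => f z.2 := hf.comp measurable_snd
  have hh1 : Measurable fun z : X × X => h z.1 := hh.comp measurable_fst
  have hk := H.measurable_kernel o α β l
  set g : X × X → ℝ≥0∞ :=
    fun z => ENNReal.ofReal (kernel d o α β l z.1 z.2) * (f z.2 * h z.1) with hg
  have hgm : Measurable g := by fun_prop
  set E₁ : Set (X × X) := {z | K * d z.2 o < d z.1 o}
  set E₂ : Set (X × X) := {z | K * d z.1 o < d z.2 o}
  set E₃ : Set (X × X) := {z | (d z.1 o ≤ K * d z.2 o ∧ d z.2 o ≤ K * d z.1 o) ∧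
    h z.1 ^ r ≤ f z.2 ^ p}
  set E₄ : Set (X × X) := {z | (d z.2 o ≤ K * d z.1 o ∧ d z.1 o ≤ K * d z.2 o) ∧
    f z.2 ^ p ≤ h z.1 ^ r}
  have hE₁ : MeasurableSet E₁ := measurableSet_lt (hm2.const_mul K) hm1
  have hE₂ : MeasurableSet E₂ := measurableSet_lt (hm1.const_mul K) hm2
  have hE₃ : MeasurableSet E₃ := ((measurableSet_le hm1 (hm2.const_mul K)).inter
    (measurableSet_le hm2 (hm1.const_mul K))).inter
    (measurableSet_le (hh1.pow_const r) (hf2.pow_const p))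
  have hE₄ : MeasurableSet E₄ := ((measurableSet_le hm2 (hm1.const_mul K)).inter
    (measurableSet_le hm1 (hm2.const_mul K))).inter
    (measurableSet_le (hf2.pow_const p) (hh1.pow_const r))
  have cover : (Set.univ : Set (X × X)) ⊆ (E₁ ∪ E₂) ∪ (E₃ ∪ E₄) := by
    intro z _
    rcases lt_or_ge (K * d z.2 o) (d z.1 o) with c1 | c1
    · exact Or.inl (Or.inl c1)
    rcases lt_or_ge (K * d z.1 o) (d z.2 o) with c2 | c2
    · exact Or.inl (Or.inr c2)
    rcases le_total (h z.1 ^ r) (f z.2 ^ p) with c3 | c3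
    · exact Or.inr (Or.inl ⟨⟨c1, c2⟩, c3⟩)
    · exact Or.inr (Or.inr ⟨⟨c2, c1⟩, c3⟩)
  have b₁ : ∫⁻ z in E₁, g z ∂(μ.prod μ) ≤ C₁ := by
    rw [setLIntegral_prod_eq hE₁ hgm]
    exact h₁ f h hf hh hF hH
  have b₂ : ∫⁻ z in E₂, g z ∂(μ.prod μ) ≤ C₂ := by
    rw [setLIntegral_prod_symm_eq hE₂ hgm]
    refine le_trans (le_of_eq ?_) (h₂ h f hh hf hH hF)
    simp only [hg, H.kernel_swap, mul_comm (h _)]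
    rfl
  have b₃ : ∫⁻ z in E₃, g z ∂(μ.prod μ) ≤ C₃ := by
    rw [setLIntegral_prod_symm_eq hE₃ hgm]
    exact h₃ f h hf hh hF hH
  have b₄ : ∫⁻ z in E₄, g z ∂(μ.prod μ) ≤ C₄ := by
    rw [setLIntegral_prod_eq hE₄ hgm]
    refine le_trans (le_of_eq ?_) (h₄ h f hh hf hH hF)
    simp only [hg, H.kernel_swap, mul_comm (h _)]
    rfl
  calc ∫⁻ z, g z ∂(μ.prod μ) = ∫⁻ z in Set.univ, g z ∂(μ.prod μ) := by rw [setLIntegral_univ]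
    _ ≤ ∫⁻ z in (E₁ ∪ E₂) ∪ (E₃ ∪ E₄), g z ∂(μ.prod μ) := lintegral_mono_set cover
    _ ≤ (∫⁻ z in E₁, g z ∂(μ.prod μ) + ∫⁻ z in E₂, g z ∂(μ.prod μ)) +
        (∫⁻ z in E₃, g z ∂(μ.prod μ) + ∫⁻ z in E₄, g z ∂(μ.prod μ)) :=
        (lintegral_union_le _ _ _).trans
          (add_le_add (lintegral_union_le _ _ _) (lintegral_union_le _ _ _))
    _ ≤ _ := add_le_add (add_le_add b₁ b₂) (add_le_add b₃ b₄)

/-- The bilinear Stein–Weiss inequality on a quasi-metric space with upper regular measure. -/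
theorem IsUpperRegular.lintegral_kernel_le [SFinite μ]
    (H : IsUpperRegular μ d K Q A) (o : X)
    {p p' q r α β l : ℝ} (hpp : p.HolderConjugate p') (hqr : q.HolderConjugate r) (hpq : p ≤ q)
    (hl : 0 ≤ l) (hlQ : l < Q) (hα : α < Q / p') (hβ : β < Q / q) (hαβ : 0 ≤ α + β)
    (hscale : α + β + l = Q / p' + Q / q) :
    ∃ C : ℝ≥0∞, C ≠ ⊤ ∧ ∀ f h : X → ℝ≥0∞, AEMeasurable f μ → AEMeasurable h μ →
      ∫⁻ z, ENNReal.ofReal (kernel d o α β l z.1 z.2) * (f z.2 * h z.1) ∂(μ.prod μ) ≤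
        C * (∫⁻ x, f x ^ p ∂μ) ^ p⁻¹ * (∫⁻ x, h x ^ r ∂μ) ^ r⁻¹ := by
  obtain ⟨C, hC, key⟩ :=
    H.lintegral_kernel_le_of_norm_le_one o hpp hqr hpq hl hlQ hα hβ hαβ hscale
  -- A positive constant makes the right-hand side `⊤` when one of the norms is `⊤`.
  refine ⟨C + 1, by simpa using hC, ?_⟩
  have hp0 := hpp.pos
  have hr0 := hqr.symm.pos
  have norm : ∀ {s : ℝ} {f : X → ℝ≥0∞}, 0 < s → Measurable f →
      (∫⁻ x, f x ^ s ∂μ) ^ s⁻¹ ≠ 0 → (∫⁻ x, f x ^ s ∂μ) ^ s⁻¹ ≠ ⊤ →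
      ∫⁻ x, (((∫⁻ x, f x ^ s ∂μ) ^ s⁻¹)⁻¹ * f x) ^ s ∂μ ≤ 1 := by
    intro s f hs hf h0 h1
    simp_rw [ENNReal.mul_rpow_of_nonneg _ _ hs.le]
    rw [lintegral_const_mul _ (by fun_prop), ENNReal.inv_rpow, ← ENNReal.rpow_mul,
      inv_mul_cancel₀ hs.ne', ENNReal.rpow_one]
    exact ENNReal.inv_mul_le_one _
  suffices meas : ∀ f h : X → ℝ≥0∞, Measurable f → Measurable h →
      ∫⁻ z, ENNReal.ofReal (kernel d o α β l z.1 z.2) * (f z.2 * h z.1) ∂(μ.prod μ) ≤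
        (C + 1) * (∫⁻ x, f x ^ p ∂μ) ^ p⁻¹ * (∫⁻ x, h x ^ r ∂μ) ^ r⁻¹ by
    intro f h hf hh
    have e1 : ∫⁻ x, f x ^ p ∂μ = ∫⁻ x, hf.mk f x ^ p ∂μ :=
      lintegral_congr_ae (by filter_upwards [hf.ae_eq_mk] with x hx; rw [← hx])
    have e2 : ∫⁻ x, h x ^ r ∂μ = ∫⁻ x, hh.mk h x ^ r ∂μ :=
      lintegral_congr_ae (by filter_upwards [hh.ae_eq_mk] with x hx; rw [← hx])
    have e3 : ∫⁻ z, ENNReal.ofReal (kernel d o α β l z.1 z.2) * (f z.2 * h z.1) ∂(μ.prod μ) =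
        ∫⁻ z, ENNReal.ofReal (kernel d o α β l z.1 z.2) * (hf.mk f z.2 * hh.mk h z.1)
          ∂(μ.prod μ) := by
      refine lintegral_congr_ae ?_
      filter_upwards [Measure.quasiMeasurePreserving_snd.ae hf.ae_eq_mk,
        Measure.quasiMeasurePreserving_fst.ae hh.ae_eq_mk] with z h1 h2
      rw [h1, h2]
    rw [e1, e2, e3]
    exact meas _ _ hf.measurable_mk hh.measurable_mk
  intro f h hf hh
  set a := (∫⁻ x, f x ^ p ∂μ) ^ p⁻¹ with ha
  set b := (∫⁻ x, h x ^ r ∂μ) ^ r⁻¹ with hb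
  have hk := H.measurable_kernel o α β l
  rcases eq_or_ne a 0 with ha0 | ha0
  · have hf0 : f =ᵐ[μ] 0 := by
      rw [ha, ENNReal.rpow_eq_zero_iff_of_pos (by positivity),
        lintegral_eq_zero_iff (by fun_prop)] at ha0
      filter_upwards [ha0] with x hx
      simpa [hp0, hp0.not_gt] using hx
    refine le_trans (le_of_eq ?_) zero_le
    refine lintegral_eq_zero_of_ae_eq_zero ?_
    filter_upwards [Measure.quasiMeasurePreserving_snd.ae hf0] with z hz
    simp [hz]
  rcases eq_or_ne b 0 with hb0 | hb0
  · have hh0 : h =ᵐ[μ] 0 := by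
      rw [hb, ENNReal.rpow_eq_zero_iff_of_pos (by positivity),
        lintegral_eq_zero_iff (by fun_prop)] at hb0
      filter_upwards [hb0] with x hx
      simpa [hr0, hr0.not_gt] using hx
    refine le_trans (le_of_eq ?_) zero_le
    refine lintegral_eq_zero_of_ae_eq_zero ?_
    filter_upwards [Measure.quasiMeasurePreserving_fst.ae hh0] with z hz
    simp [hz]
  rcases eq_or_ne a ⊤ with ha1 | ha1
  · rw [ha1, ENNReal.mul_top (by simp), ENNReal.top_mul hb0]; exact le_top
  rcases eq_or_ne b ⊤ with hb1 | hb1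
  · rw [hb1, ENNReal.mul_top (by simp [ha0])]; exact le_top
  have := key (fun x => a⁻¹ * f x) (fun x => b⁻¹ * h x) (by fun_prop) (by fun_prop)
    (norm hp0 hf ha0 ha1) (norm hr0 hh hb0 hb1)
  calc _ = ∫⁻ z, (a * b) * (ENNReal.ofReal (kernel d o α β l z.1 z.2) *
        (a⁻¹ * f z.2 * (b⁻¹ * h z.1))) ∂(μ.prod μ) := by
        refine lintegral_congr fun z => ?_
        calc _ = (a * a⁻¹) * (b * b⁻¹) *
              (ENNReal.ofReal (kernel d o α β l z.1 z.2) * (f z.2 * h z.1)) := by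
              rw [ENNReal.mul_inv_cancel ha0 ha1, ENNReal.mul_inv_cancel hb0 hb1, one_mul, one_mul]
          _ = _ := by ring
    _ ≤ (a * b) * (C + 1) := by
        rw [lintegral_const_mul' _ _ (ENNReal.mul_ne_top ha1 hb1)]
        gcongr
        exact this.trans le_self_add
    _ = _ := by ring

end Bilinear

/-! ### Duality -/

section Duality

variable {X : Type*} [MeasurableSpace X] {μ : Measure X}

/-- The converse of Hölder's inequality on a `σ`-finite space. It is tested on powers of
truncations of `g`, whose `L ^ q` norms are finite. -/
lemma lintegral_rpow_le_of_forall_lintegral_mul_le [SigmaFinite μ] {q r : ℝ}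
    (hqr : q.HolderConjugate r) {g : X → ℝ≥0∞} (hg : Measurable g) {C : ℝ≥0∞}
    (hC : ∀ h : X → ℝ≥0∞, Measurable h → ∫⁻ x, g x * h x ∂μ ≤ C * (∫⁻ x, h x ^ r ∂μ) ^ r⁻¹) :
    (∫⁻ x, g x ^ q ∂μ) ^ q⁻¹ ≤ C := by
  have hq0 := hqr.pos
  have hq1 := hqr.sub_one_pos
  set S := spanningSets μ
  set T : ℕ → X → ℝ≥0∞ := fun n => (S n).indicator fun x => min (g x) n with hT
  have hTm : ∀ n, Measurable (T n) := fun n =>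
    (hg.min measurable_const).indicator (measurableSet_spanningSets μ n)
  have hTg : ∀ n x, T n x ≤ g x := fun n x =>
    Set.indicator_le' (fun x _ => min_le_left _ _) (fun _ _ => zero_le) x
  have hmono : Monotone T := fun m n hmn x => by
    by_cases hx : x ∈ S m
    · simp only [hT]
      rw [Set.indicator_of_mem hx, Set.indicator_of_mem (monotone_spanningSets μ hmn hx)]
      gcongr
    · simp [hT, Set.indicator_of_notMem hx]
  have bound : ∀ n, ∫⁻ x, T n x ^ q ∂μ ≤ C ^ q := by
    intro n
    set I := ∫⁻ x, T n x ^ q ∂μ with hI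
    have hIfin : I ≠ ⊤ := by
      refine ne_top_of_le_ne_top (b := ∫⁻ x in S n, (n : ℝ≥0∞) ^ q ∂μ) ?_ ?_
      · rw [setLIntegral_const]
        exact ENNReal.mul_ne_top (ENNReal.rpow_ne_top_of_nonneg hq0.le (by simp))
          (measure_spanningSets_lt_top μ n).ne
      · rw [← lintegral_indicator (measurableSet_spanningSets μ n)]
        refine lintegral_mono fun x => ?_
        by_cases hx : x ∈ S n
        · simp only [hT]
          rw [Set.indicator_of_mem hx, Set.indicator_of_mem hx]
          gcongr
          exact min_le_right _ _
        · simp only [hT]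
          rw [Set.indicator_of_notMem hx, Set.indicator_of_notMem hx, ENNReal.zero_rpow_of_pos hq0]
    have step : I ≤ C * I ^ r⁻¹ := by
      have h1 := hC (fun x => T n x ^ (q - 1)) ((hTm n).pow_const _)
      have h2 : ∀ x, (T n x ^ (q - 1)) ^ r = T n x ^ q := fun x => by
        rw [← ENNReal.rpow_mul, hqr.sub_one_mul_conj]
      simp only [h2] at h1
      refine le_trans (lintegral_mono fun x => ?_) h1
      calc T n x ^ q = T n x ^ (1 + (q - 1)) := by congr 1; ring
        _ = T n x * T n x ^ (q - 1) := by
            rw [ENNReal.rpow_add_of_nonneg _ _ zero_le_one hq1.le, ENNReal.rpow_one]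
        _ ≤ g x * T n x ^ (q - 1) := by gcongr; exact hTg n x
    rcases eq_or_ne I 0 with h0 | h0
    · rw [h0]; exact zero_le
    have hdiv : I ^ q⁻¹ ≤ C := by
      have hr0 : I ^ r⁻¹ ≠ 0 := by simp [h0, hIfin]
      have hr1 : I ^ r⁻¹ ≠ ⊤ := ENNReal.rpow_ne_top_of_nonneg hqr.symm.inv_nonneg hIfin
      have : I ^ q⁻¹ * I ^ r⁻¹ = I := by
        rw [← ENNReal.rpow_add _ _ h0 hIfin, hqr.inv_add_inv_eq_one, ENNReal.rpow_one]
      rw [← this] at step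
      refine (ENNReal.mul_le_mul_iff_left hr0 hr1).1 ?_
      rwa [this] at step ⊢
    calc I = (I ^ q⁻¹) ^ q := by rw [← ENNReal.rpow_mul, inv_mul_cancel₀ hq0.ne', ENNReal.rpow_one]
      _ ≤ C ^ q := by gcongr
  have hlim : Filter.Tendsto (fun n => ∫⁻ x, T n x ^ q ∂μ) Filter.atTop
      (nhds (∫⁻ x, g x ^ q ∂μ)) := by
    refine lintegral_tendsto_of_tendsto_of_monotone (fun n => ((hTm n).pow_const q).aemeasurable)
      (Filter.Eventually.of_forall fun x m n hmn => ENNReal.rpow_le_rpow (hmono hmn x) hq0.le)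
      (Filter.Eventually.of_forall fun x => ?_)
    refine (ENNReal.continuous_rpow_const.tendsto _).comp ?_
    have h1 : Filter.Tendsto (fun n : ℕ => min (g x) n) Filter.atTop (nhds (g x)) := by
      simpa using (tendsto_const_nhds (x := g x)).min ENNReal.tendsto_nat_nhds_top
    refine h1.congr' ?_
    obtain ⟨n₀, hn₀⟩ : ∃ n, x ∈ S n := by
      have : x ∈ ⋃ n, S n := by rw [iUnion_spanningSets]; trivial
      simpa using this
    filter_upwards [Filter.eventually_ge_atTop n₀] with n hn
    simp only [hT]
    rw [Set.indicator_of_mem (monotone_spanningSets μ hn hn₀)]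
  calc _ ≤ (C ^ q) ^ q⁻¹ := by
        gcongr
        exact le_of_tendsto' hlim bound
    _ = C := by rw [← ENNReal.rpow_mul, mul_inv_cancel₀ hq0.ne', ENNReal.rpow_one]

/-- A bilinear bound for a non-negative kernel gives the bound for the integral operator. -/
lemma lintegral_operator_le_of_bilinear [SigmaFinite μ] {p q r : ℝ}
    (hqr : q.HolderConjugate r) {k : X → X → ℝ≥0∞} (hk : Measurable fun z : X × X => k z.1 z.2)
    {C : ℝ≥0∞}
    (hC : ∀ f h : X → ℝ≥0∞, AEMeasurable f μ → AEMeasurable h μ →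
      ∫⁻ z, k z.1 z.2 * (f z.2 * h z.1) ∂(μ.prod μ) ≤
        C * (∫⁻ x, f x ^ p ∂μ) ^ p⁻¹ * (∫⁻ x, h x ^ r ∂μ) ^ r⁻¹)
    {f : X → ℝ≥0∞} (hf : AEMeasurable f μ) :
    (∫⁻ x, (∫⁻ y, k x y * f y ∂μ) ^ q ∂μ) ^ q⁻¹ ≤ C * (∫⁻ x, f x ^ p ∂μ) ^ p⁻¹ := by
  have e1 : ∫⁻ x, f x ^ p ∂μ = ∫⁻ x, hf.mk f x ^ p ∂μ :=
    lintegral_congr_ae (by filter_upwards [hf.ae_eq_mk] with x hx; rw [← hx])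
  have e2 : ∀ x, ∫⁻ y, k x y * f y ∂μ = ∫⁻ y, k x y * hf.mk f y ∂μ := fun x =>
    lintegral_congr_ae (by filter_upwards [hf.ae_eq_mk] with x hx; rw [← hx])
  simp only [e1, e2]
  have hm : Measurable fun z : X × X => k z.1 z.2 * hf.mk f z.2 :=
    hk.mul (hf.measurable_mk.comp measurable_snd)
  refine lintegral_rpow_le_of_forall_lintegral_mul_le hqr hm.lintegral_prod_right' fun h hh => ?_
  refine le_trans (le_of_eq ?_) (hC _ h hf.measurable_mk.aemeasurable hh.aemeasurable)
  have hm' : Measurable fun z : X × X => k z.1 z.2 * (hf.mk f z.2 * h z.1) :=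
    hk.mul ((hf.measurable_mk.comp measurable_snd).mul (hh.comp measurable_fst))
  rw [lintegral_prod _ hm'.aemeasurable]
  refine lintegral_congr fun x => ?_
  have hmx : Measurable fun y => k x y * hf.mk f y := hm.comp measurable_prodMk_left
  rw [← lintegral_mul_const _ hmx]
  refine lintegral_congr fun y => ?_
  ring

lemma eLpNorm_ofReal_eq {E : Type*} [NormedAddCommGroup E] {p : ℝ} (hp : 0 < p) (f : X → E) :
    eLpNorm f (ENNReal.ofReal p) μ = (∫⁻ x, ‖f x‖ₑ ^ p ∂μ) ^ p⁻¹ := by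
  rw [eLpNorm_eq_lintegral_rpow_enorm_toReal (by simpa using hp) ENNReal.ofReal_ne_top,
    ENNReal.toReal_ofReal hp.le, one_div]

end Duality

/-! ### The Stein–Weiss inequality on quasi-metric spaces -/

section SteinWeissInequality

variable {X : Type*} [MeasurableSpace X] {μ : Measure X} {d : X → X → ℝ} {K Q A : ℝ}

/-- The Stein–Weiss inequality on a quasi-metric space with upper regular measure, in operator
and in bilinear form. -/
theorem IsUpperRegular.steinWeiss [SigmaFinite μ] {𝕜 : Type*} [RCLike 𝕜]
    (H : IsUpperRegular μ d K Q A) (o : X)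
    {p p' q q' α β l : ℝ} (hpp : p.HolderConjugate p') (hqq : q.HolderConjugate q') (hpq : p ≤ q)
    (hl : 0 ≤ l) (hlQ : l < Q) (hα : α < Q / p') (hβ : β < Q / q) (hαβ : 0 ≤ α + β)
    (hscale : α + β + l = Q / p' + Q / q) :
    ∃ C : ℝ, 0 < C ∧
      (∀ u : X → 𝕜, MemLp (fun x => d x o ^ α • u x) (ENNReal.ofReal p) μ →
        (∀ᵐ x ∂μ, Integrable (fun y => d x y ^ (-l) • u y) μ) ∧
        MemLp (fun x => d x o ^ (-β) • ∫ y, d x y ^ (-l) • u y ∂μ) (ENNReal.ofReal q) μ ∧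
        eLpNorm (fun x => d x o ^ (-β) • ∫ y, d x y ^ (-l) • u y ∂μ) (ENNReal.ofReal q) μ
          ≤ ENNReal.ofReal C * eLpNorm (fun x => d x o ^ α • u x) (ENNReal.ofReal p) μ) ∧
      (∀ u h : X → 𝕜, MemLp u (ENNReal.ofReal p) μ → MemLp h (ENNReal.ofReal q') μ →
        Integrable (fun z : X × X => kernel d o α β l z.1 z.2 • (u z.2 * h z.1)) (μ.prod μ) ∧
        ‖∫ z : X × X, kernel d o α β l z.1 z.2 • (u z.2 * h z.1) ∂(μ.prod μ)‖ₑ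
          ≤ ENNReal.ofReal C * eLpNorm u (ENNReal.ofReal p) μ *
              eLpNorm h (ENNReal.ofReal q') μ) := by
  obtain ⟨C, hC, key⟩ := H.lintegral_kernel_le o hpp hqq hpq hl hlQ hα hβ hαβ hscale
  have hp0 := hpp.pos
  have hq0 := hqq.pos
  have hq'0 := hqq.symm.pos
  have hCle : C ≤ ENNReal.ofReal (C.toReal + 1) := by
    rw [ENNReal.le_ofReal_iff_toReal_le hC (by positivity)]
    linarith
  have hk := H.measurable_kernel o α β l
  have hd := H.measurable_left o
  refine ⟨C.toReal + 1, by positivity, fun u hu => ?_, fun u h hu hh => ?_⟩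
  · set f : X → ℝ≥0∞ := fun y => ‖d y o ^ α • u y‖ₑ with hf
    have hfm : AEMeasurable f μ := hu.1.enorm
    have hum : AEStronglyMeasurable u μ := by
      have h1 : AEStronglyMeasurable (fun y => d y o ^ (-α) • (d y o ^ α • u y)) μ :=
        ((hd.pow_const (-α)).aestronglyMeasurable).smul hu.1
      refine h1.congr ?_
      filter_upwards [H.ae_dist_pos o] with y hy
      rw [smul_smul, ← Real.rpow_add hy, neg_add_cancel, Real.rpow_zero, one_smul]
    have hdl : ∀ x, Measurable fun y => d x y ^ (-l) := fun x =>
      (H.measurable_right x).pow_const (-l)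
    have hnorm : ∀ x, ENNReal.ofReal (d x o ^ (-β)) * ∫⁻ y, ‖d x y ^ (-l) • u y‖ₑ ∂μ =
        ∫⁻ y, ENNReal.ofReal (kernel d o α β l x y) * f y ∂μ := by
      intro x
      rw [← lintegral_const_mul' _ _ ENNReal.ofReal_ne_top]
      refine lintegral_congr_ae ?_
      filter_upwards [H.ae_dist_pos o] with y hy
      have h1 := Real.rpow_nonneg (H.nonneg x o) (-β)
      have h2 := Real.rpow_nonneg (H.nonneg x y) (-l)
      have h3 : ENNReal.ofReal (d y o ^ (-α)) * ENNReal.ofReal (d y o ^ α) = 1 := by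
        rw [← ENNReal.ofReal_mul (by positivity), ← Real.rpow_add hy]
        simp
      simp only [hf, kernel]
      rw [enorm_smul, enorm_smul, Real.enorm_of_nonneg h2, Real.enorm_of_nonneg (by positivity),
        ENNReal.ofReal_mul (by positivity), ENNReal.ofReal_mul h1]
      calc _ = ENNReal.ofReal (d x o ^ (-β)) * (ENNReal.ofReal (d x y ^ (-l)) * ‖u y‖ₑ) *
            (ENNReal.ofReal (d y o ^ (-α)) * ENNReal.ofReal (d y o ^ α)) := by rw [h3, mul_one]
        _ = _ := by ring
    have main : (∫⁻ x, (∫⁻ y, ENNReal.ofReal (kernel d o α β l x y) * f y ∂μ) ^ q ∂μ) ^ q⁻¹ ≤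
        C * eLpNorm (fun x => d x o ^ α • u x) (ENNReal.ofReal p) μ := by
      rw [eLpNorm_ofReal_eq hp0]
      exact lintegral_operator_le_of_bilinear hqq
        (k := fun x y => ENNReal.ofReal (kernel d o α β l x y)) hk.ennreal_ofReal key hfm
    have hfin : ∀ᵐ x ∂μ, ∫⁻ y, ENNReal.ofReal (kernel d o α β l x y) * f y ∂μ < ⊤ := by
      have hm : AEMeasurable (fun x => ∫⁻ y, ENNReal.ofReal (kernel d o α β l x y) * f y ∂μ) μ := by
        have : AEMeasurable (fun z : X × X => ENNReal.ofReal (kernel d o α β l z.1 z.2) * f z.2)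
            (μ.prod μ) := hk.ennreal_ofReal.aemeasurable.mul hfm.comp_snd
        exact this.lintegral_prod_right'
      have h1 : ∫⁻ x, (∫⁻ y, ENNReal.ofReal (kernel d o α β l x y) * f y ∂μ) ^ q ∂μ ≠ ⊤ := by
        intro htop
        rw [htop, ENNReal.top_rpow_of_pos (by positivity)] at main
        exact (ENNReal.mul_lt_top hC.lt_top hu.2).not_ge main
      filter_upwards [ae_lt_top' (hm.pow_const q) h1] with x hx
      by_contra hneg
      rw [not_lt, top_le_iff] at hneg
      simp [hneg, hq0] at hx
    have hle : eLpNorm (fun x => d x o ^ (-β) • ∫ y, d x y ^ (-l) • u y ∂μ) (ENNReal.ofReal q) μ ≤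
        ENNReal.ofReal (C.toReal + 1) *
          eLpNorm (fun x => d x o ^ α • u x) (ENNReal.ofReal p) μ := by
      calc _ ≤ (∫⁻ x, (∫⁻ y, ENNReal.ofReal (kernel d o α β l x y) * f y ∂μ) ^ q ∂μ) ^ q⁻¹ := by
            rw [eLpNorm_ofReal_eq hq0]
            gcongr with x
            rw [← hnorm x, enorm_smul, Real.enorm_of_nonneg (Real.rpow_nonneg (H.nonneg x o) _)]
            gcongr
            exact enorm_integral_le_lintegral_enorm _
        _ ≤ _ := main.trans (by gcongr)
    refine ⟨?_, ⟨?_, hle.trans_lt (ENNReal.mul_lt_top ENNReal.ofReal_lt_top hu.2)⟩, hle⟩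
    · filter_upwards [hfin, H.ae_dist_pos o] with x hx hxo
      refine ⟨(hdl x).aestronglyMeasurable.smul hum, ?_⟩
      rw [← hnorm x] at hx
      have h0 : ENNReal.ofReal (d x o ^ (-β)) ≠ 0 := by
        simpa using Real.rpow_pos_of_pos hxo (-β)
      rcases ENNReal.mul_lt_top_iff.1 hx with h1 | h1 | h1
      · exact h1.2
      · exact absurd h1 h0
      · exact h1.trans_lt ENNReal.zero_lt_top
    · refine (hd.pow_const (-β)).aestronglyMeasurable.smul ?_
      have : AEStronglyMeasurable (fun z : X × X => d z.1 z.2 ^ (-l) • u z.2) (μ.prod μ) :=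
        (H.measurable.pow_const (-l)).aestronglyMeasurable.smul hum.comp_snd
      exact this.integral_prod_right'
  · have hm : AEStronglyMeasurable
        (fun z : X × X => kernel d o α β l z.1 z.2 • (u z.2 * h z.1)) (μ.prod μ) :=
      hk.aestronglyMeasurable.smul (hu.1.comp_snd.mul hh.1.comp_fst)
    have hle : ∫⁻ z : X × X, ‖kernel d o α β l z.1 z.2 • (u z.2 * h z.1)‖ₑ ∂(μ.prod μ) ≤
        ENNReal.ofReal (C.toReal + 1) * eLpNorm u (ENNReal.ofReal p) μ *
          eLpNorm h (ENNReal.ofReal q') μ := by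
      calc _ = ∫⁻ z : X × X, ENNReal.ofReal (kernel d o α β l z.1 z.2) *
            (‖u z.2‖ₑ * ‖h z.1‖ₑ) ∂(μ.prod μ) := by
            refine lintegral_congr fun z => ?_
            rw [enorm_smul, enorm_mul, Real.enorm_of_nonneg (H.kernel_nonneg o α β l _ _)]
        _ ≤ _ := key _ _ hu.1.enorm hh.1.enorm
        _ ≤ _ := by
            rw [eLpNorm_ofReal_eq hp0, eLpNorm_ofReal_eq hq'0]
            gcongr
    refine ⟨⟨hm, hle.trans_lt ?_⟩, (enorm_integral_le_lintegral_enorm _).trans hle⟩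
    exact ENNReal.mul_lt_top (ENNReal.mul_lt_top ENNReal.ofReal_lt_top hu.2) hh.2

end SteinWeissInequality

/-! ### Homogeneous groups as quasi-metric spaces -/

section HomogeneousGroup

variable {N : ℕ} {ν : Fin N → ℝ}

/-- The dilation `D_r` as a linear map. -/
noncomputable def dilationLinear (ν : Fin N → ℝ) (r : ℝ) :
    EuclideanSpace ℝ (Fin N) →ₗ[ℝ] EuclideanSpace ℝ (Fin N) where
  toFun := dilation ν r
  map_add' x y := by ext i; simp [dilation, mul_add]
  map_smul' c x := by ext i; simp [dilation, mul_left_comm]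

lemma det_dilationLinear (ν : Fin N → ℝ) {r : ℝ} (hr : 0 < r) :
    LinearMap.det (dilationLinear ν r) = r ^ homogeneousDim ν := by
  have h : LinearMap.toMatrix (EuclideanSpace.basisFun (Fin N) ℝ).toBasis
      (EuclideanSpace.basisFun (Fin N) ℝ).toBasis (dilationLinear ν r) =
      Matrix.diagonal fun i => r ^ ν i := by
    ext i j
    rw [LinearMap.toMatrix_apply]
    by_cases hij : i = j
    · subst hij
      simp [dilationLinear, dilation]
    · simp [dilationLinear, dilation, hij]
  rw [← LinearMap.det_toMatrix (EuclideanSpace.basisFun (Fin N) ℝ).toBasis, h,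
    Matrix.det_diagonal, homogeneousDim, Real.rpow_sum_of_pos hr]

lemma dilation_dilation_inv {r : ℝ} (hr : 0 < r) (x : EuclideanSpace ℝ (Fin N)) :
    dilation ν r (dilation ν r⁻¹ x) = x := by
  ext i
  simp only [dilation]
  rw [Real.inv_rpow hr.le, mul_inv_cancel_left₀ (Real.rpow_pos_of_pos hr _).ne']

variable [Group (EuclideanSpace ℝ (Fin N))]

/-- The identity element is the origin, the only fixed point of `D_2`. -/
lemma IsHomogeneousGroup.one_eq_zero (hG : IsHomogeneousGroup ν) :
    (1 : EuclideanSpace ℝ (Fin N)) = 0 := by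
  have h1 : dilation ν 2 (1 : EuclideanSpace ℝ (Fin N)) = 1 := by
    have := hG.dilation_mul 2 (by norm_num) 1 1
    rw [mul_one] at this
    exact (mul_eq_left.1 this.symm)
  ext i
  have h2 : (2 : ℝ) ^ ν i * (1 : EuclideanSpace ℝ (Fin N)) i = (1 : EuclideanSpace ℝ (Fin N)) i :=
    congrArg (fun v : EuclideanSpace ℝ (Fin N) => v i) h1
  have h3 : (1 : ℝ) < 2 ^ ν i := Real.one_lt_rpow (by norm_num) (hG.weight_pos i)
  have h4 : ((2 : ℝ) ^ ν i - 1) * (1 : EuclideanSpace ℝ (Fin N)) i = 0 := by linarith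
  simpa [(sub_pos.2 h3).ne'] using h4

lemma IsHomogeneousGroup.isTopologicalGroup (hG : IsHomogeneousGroup ν) :
    IsTopologicalGroup (EuclideanSpace ℝ (Fin N)) :=
  have := hG.lieGroup
  topologicalGroup_of_lieGroup 𝓘(ℝ, EuclideanSpace ℝ (Fin N)) ∞

lemma IsHomogeneousGroup.contDiff_mul (hG : IsHomogeneousGroup ν) :
    ContDiff ℝ ∞ fun z : EuclideanSpace ℝ (Fin N) × EuclideanSpace ℝ (Fin N) => z.1 * z.2 := by
  have := hG.lieGroup
  have h := _root_.contMDiff_mul 𝓘(ℝ, EuclideanSpace ℝ (Fin N)) ∞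
    (G := EuclideanSpace ℝ (Fin N))
  rwa [← modelWithCornersSelf_prod, chartedSpaceSelf_prod, contMDiff_iff_contDiff] at h

lemma IsHomogeneousGroup.differentiable_mul_left (hG : IsHomogeneousGroup ν)
    (x : EuclideanSpace ℝ (Fin N)) : Differentiable ℝ fun y => x * y :=
  (hG.contDiff_mul.differentiable (by simp)).comp
    ((differentiable_const x).prodMk differentiable_id)

lemma IsHomogeneousGroup.continuous_det_fderiv_mul_left (hG : IsHomogeneousGroup ν) :
    Continuous fun x : EuclideanSpace ℝ (Fin N) => (fderiv ℝ (fun y => x * y) 0).det := by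
  have h : ∀ x : EuclideanSpace ℝ (Fin N), fderiv ℝ (fun y => x * y) 0 =
      (fderiv ℝ (fun z : EuclideanSpace ℝ (Fin N) × EuclideanSpace ℝ (Fin N) => z.1 * z.2)
        (x, 0)).comp (ContinuousLinearMap.inr ℝ _ _) := fun x => by
    have h1 := (hG.contDiff_mul.differentiable (by simp) (x, 0)).hasFDerivAt
    exact (h1.comp (0 : EuclideanSpace ℝ (Fin N)) (hasFDerivAt_prodMk_right x 0)).fderiv
  simp only [h]
  have h2 := hG.contDiff_mul.continuous_fderiv (by simp)
  exact ContinuousLinearMap.continuous_det.comp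
    ((h2.comp (continuous_id.prodMk continuous_const)).clm_comp continuous_const)

/-- The Jacobian of left translation by `x` at the origin is one. It is continuous in `x` and, by
the chain rule for `D_r ∘ L_x = L_{D_r x} ∘ D_r`, invariant under dilations of `x`, which contract
`x` to the identity. -/
lemma IsHomogeneousGroup.det_fderiv_mul_left_zero (hG : IsHomogeneousGroup ν)
    (x : EuclideanSpace ℝ (Fin N)) : (fderiv ℝ (fun y => x * y) 0).det = 1 := by
  have inv : ∀ r : ℝ, 0 < r → (fderiv ℝ (fun y => dilation ν r x * y) 0).det =
      (fderiv ℝ (fun y => x * y) 0).det := by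
    intro r hr
    set D := LinearMap.toContinuousLinearMap (dilationLinear ν r) with hD
    have hD' : ∀ v, D v = dilation ν r v := fun v => rfl
    have e1 : HasFDerivAt (fun y => D (x * y)) (D.comp (fderiv ℝ (fun y => x * y) 0)) 0 :=
      D.hasFDerivAt.comp 0 (hG.differentiable_mul_left x 0).hasFDerivAt
    have e2 : HasFDerivAt (fun y => dilation ν r x * D y)
        ((fderiv ℝ (fun y => dilation ν r x * y) 0).comp D) 0 := by
      have h0 : D 0 = 0 := map_zero D
      have := (hG.differentiable_mul_left (dilation ν r x) (D 0)).hasFDerivAt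
      have := this.comp (0 : EuclideanSpace ℝ (Fin N)) D.hasFDerivAt
      rwa [h0] at this
    have e3 : (fun y => D (x * y)) = fun y => dilation ν r x * D y := by
      funext y
      rw [hD', hD', hG.dilation_mul r hr]
    rw [e3] at e1
    have e4 := congrArg ContinuousLinearMap.det (e1.unique e2)
    have e5 : D.det ≠ 0 := by
      have : D.det = r ^ homogeneousDim ν := det_dilationLinear ν hr
      rw [this]; positivity
    have mul_det : ∀ S T : EuclideanSpace ℝ (Fin N) →L[ℝ] EuclideanSpace ℝ (Fin N),
        (S.comp T).det = S.det * T.det := fun S T => LinearMap.det_comp _ _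
    rw [mul_det, mul_det, mul_comm] at e4
    exact (mul_right_cancel₀ e5 e4).symm
  have lim : Filter.Tendsto (fun r : ℝ => dilation ν r x) (nhdsWithin 0 (Set.Ioi 0))
      (nhds 1) := by
    have h0 : (1 : EuclideanSpace ℝ (Fin N)) = dilation ν 0 x := by
      rw [hG.one_eq_zero]
      ext i
      simp [dilation, Real.zero_rpow (hG.weight_pos i).ne']
    rw [h0]
    have hc : Continuous fun r : ℝ => dilation ν r x := by
      refine (PiLp.continuous_toLp 2 _).comp (continuous_pi fun i => ?_)
      exact (Real.continuous_rpow_const (hG.weight_pos i).le).mul continuous_const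
    exact (hc.tendsto 0).mono_left nhdsWithin_le_nhds
  have h1 := (hG.continuous_det_fderiv_mul_left.tendsto 1).comp lim
  have h2 : (fderiv ℝ (fun y : EuclideanSpace ℝ (Fin N) => 1 * y) 0).det = 1 := by
    simp only [one_mul]
    rw [fderiv_fun_id]
    exact LinearMap.det_id
  rw [h2] at h1
  refine tendsto_nhds_unique (tendsto_const_nhds.congr' ?_) h1
  filter_upwards [self_mem_nhdsWithin] with r hr using (inv r hr).symm

lemma IsHomogeneousGroup.det_fderiv_mul_left (hG : IsHomogeneousGroup ν)
    (g x : EuclideanSpace ℝ (Fin N)) : (fderiv ℝ (fun y => g * y) x).det = 1 := by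
  have e1 : HasFDerivAt (fun y => g * (x * y))
      ((fderiv ℝ (fun y => g * y) x).comp (fderiv ℝ (fun y => x * y) 0)) 0 := by
    have h := (hG.differentiable_mul_left g (x * 0)).hasFDerivAt.comp
      (0 : EuclideanSpace ℝ (Fin N)) (hG.differentiable_mul_left x 0).hasFDerivAt
    have hx : x * 0 = x := by rw [← hG.one_eq_zero, mul_one]
    rwa [hx] at h
  simp only [← mul_assoc] at e1
  have e2 : ((fderiv ℝ (fun y => g * y) x).comp (fderiv ℝ (fun y => x * y) 0)).det =
      (fderiv ℝ (fun y => g * y) x).det * (fderiv ℝ (fun y => x * y) 0).det :=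
    LinearMap.det_comp _ _
  rw [← e1.fderiv, hG.det_fderiv_mul_left_zero, hG.det_fderiv_mul_left_zero, mul_one] at e2
  exact e2.symm

/-- Lebesgue measure is a Haar measure of a homogeneous group. -/
lemma IsHomogeneousGroup.isHaarMeasure_volume (hG : IsHomogeneousGroup ν) :
    (volume : Measure (EuclideanSpace ℝ (Fin N))).IsHaarMeasure := by
  have := hG.isTopologicalGroup
  have : (volume : Measure (EuclideanSpace ℝ (Fin N))).IsMulLeftInvariant := by
    refine ⟨fun g => ?_⟩
    ext s hs
    rw [Measure.map_apply (measurable_const_mul g) hs]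
    have himg : (fun y => g * y) ⁻¹' s = (fun y => g⁻¹ * y) '' s := by
      ext y
      constructor
      · intro hy
        exact ⟨g * y, hy, by simp⟩
      · rintro ⟨z, hz, rfl⟩
        simpa using hz
    rw [himg, ← lintegral_abs_det_fderiv_eq_addHaar_image volume hs
      (fun x _ => (hG.differentiable_mul_left g⁻¹ x).hasFDerivAt.hasFDerivWithinAt)
      (mul_right_injective g⁻¹).injOn]
    simp [hG.det_fderiv_mul_left]
  exact { }

/-- A Haar measure scales under dilations with the homogeneous dimension. -/
lemma IsHomogeneousGroup.measure_image_dilation (hG : IsHomogeneousGroup ν)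
    (μ : Measure (EuclideanSpace ℝ (Fin N))) [μ.IsHaarMeasure] {r : ℝ} (hr : 0 < r)
    (s : Set (EuclideanSpace ℝ (Fin N))) :
    μ (dilation ν r '' s) = ENNReal.ofReal (r ^ homogeneousDim ν) * μ s := by
  have := hG.isTopologicalGroup
  have := hG.isHaarMeasure_volume
  have h : (volume : Measure (EuclideanSpace ℝ (Fin N))) (dilation ν r '' s) =
      ENNReal.ofReal (r ^ homogeneousDim ν) * volume s := by
    have := Measure.addHaar_image_linearMap volume (dilationLinear ν r) s
    rw [det_dilationLinear ν hr, abs_of_nonneg (by positivity)] at this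
    exact this
  rw [Measure.isMulLeftInvariant_eq_smul μ volume]
  simp only [Measure.smul_apply, h]
  simp only [ENNReal.smul_def, smul_eq_mul]
  ring

/-- The closed unit ball of a homogeneous quasi-norm is compact: with `m` the minimum of `ρ` on the
Euclidean unit sphere, it is contained in the image of the Euclidean unit ball under `D_{1/m}`. -/
lemma IsHomogeneousQuasiNorm.isCompact_closedUnitBall (hG : IsHomogeneousGroup ν)
    {ρ : EuclideanSpace ℝ (Fin N) → ℝ} (hρ : IsHomogeneousQuasiNorm ν ρ) :
    IsCompact {x | ρ x ≤ 1} := by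
  rcases isEmpty_or_nonempty (Fin N) with hN | hN
  · exact Set.Subsingleton.isCompact (fun x _ y _ => Subsingleton.elim x y)
  obtain ⟨s₀, hs₀, hmin⟩ := (isCompact_sphere (0 : EuclideanSpace ℝ (Fin N)) 1).exists_isMinOn
    (NormedSpace.sphere_nonempty.2 zero_le_one) hρ.continuous.continuousOn
  set m := ρ s₀ with hm
  have hm0 : 0 < m := by
    refine lt_of_le_of_ne (hρ.nonneg s₀) fun h => ?_
    rw [eq_comm, hρ.eq_zero_iff] at h
    simp [h] at hs₀
  -- `D_m` maps the quasi-norm ball into the Euclidean unit ball: otherwise some `r < m` would put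
  -- `D_r x` on the sphere, whence `m ≤ ρ (D_r x) = r * ρ x < m`.
  have hbound : ∀ x, ρ x ≤ 1 → x ∈ SteinWeiss.dilation ν m⁻¹ '' Metric.closedBall 0 1 := by
    intro x hx
    refine ⟨SteinWeiss.dilation ν m x, ?_, ?_⟩
    · by_contra hbig
      rw [mem_closedBall_zero_iff, not_le] at hbig
      have hc : Continuous fun r : ℝ => ‖SteinWeiss.dilation ν r x‖ := by
        refine ((PiLp.continuous_toLp 2 _).comp (continuous_pi fun i => ?_)).norm
        exact (Real.continuous_rpow_const (hG.weight_pos i).le).mul continuous_const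
      have h0 : ‖SteinWeiss.dilation ν 0 x‖ = 0 := by
        rw [norm_eq_zero]
        ext i
        simp [SteinWeiss.dilation, Real.zero_rpow (hG.weight_pos i).ne']
      obtain ⟨r, ⟨hr0, hrm⟩, hr1⟩ := intermediate_value_Icc hm0.le hc.continuousOn
        ⟨by simp [h0], hbig.le⟩
      simp only at hr1
      have hr0' : 0 < r := lt_of_le_of_ne hr0 fun h => by rw [← h, h0] at hr1; norm_num at hr1
      have hrm' : r < m := lt_of_le_of_ne hrm fun h => by rw [h] at hr1; linarith
      have h1 : m ≤ ρ (SteinWeiss.dilation ν r x) := hmin (by simpa using hr1)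
      rw [hρ.dilation r hr0'] at h1
      nlinarith [hρ.nonneg x]
    · have := dilation_dilation_inv (ν := ν) (inv_pos.2 hm0) x
      rwa [inv_inv] at this
  refine IsCompact.of_isClosed_subset (IsCompact.image (isCompact_closedBall 0 1) ?_)
    (isClosed_le hρ.continuous continuous_const) hbound
  exact (dilationLinear ν m⁻¹).continuous_of_finiteDimensional

/-- The quasi-triangle inequality, by compactness of the unit ball and homogeneity. -/
lemma IsHomogeneousQuasiNorm.exists_mul_le (hG : IsHomogeneousGroup ν)
    {ρ : EuclideanSpace ℝ (Fin N) → ℝ} (hρ : IsHomogeneousQuasiNorm ν ρ) :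
    ∃ K, 1 ≤ K ∧ ∀ x y, ρ (x * y) ≤ K * max (ρ x) (ρ y) := by
  have := hG.isTopologicalGroup
  have hB := hρ.isCompact_closedUnitBall hG
  obtain ⟨K, hK⟩ := (hB.prod hB).bddAbove_image
    (f := fun z : EuclideanSpace ℝ (Fin N) × EuclideanSpace ℝ (Fin N) => ρ (z.1 * z.2))
    (hρ.continuous.comp continuous_mul).continuousOn
  refine ⟨max K 1, le_max_right _ _, fun x y => ?_⟩
  set t := max (ρ x) (ρ y) with ht
  rcases (le_max_of_le_left (hρ.nonneg x) : 0 ≤ t).eq_or_lt with h0 | h0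
  · have hx : ρ x = 0 := le_antisymm ((le_max_left _ _).trans h0.ge) (hρ.nonneg x)
    have hy : ρ y = 0 := le_antisymm ((le_max_right _ _).trans h0.ge) (hρ.nonneg y)
    rw [hρ.eq_zero_iff] at hx hy
    have : ρ (x * y) = 0 := by
      rw [hx, hy, hρ.eq_zero_iff, ← hG.one_eq_zero, mul_one]
    rw [this]
    positivity
  · have hin : ∀ w, ρ w ≤ t → ρ (SteinWeiss.dilation ν t⁻¹ w) ≤ 1 := fun w hw => by
      rw [hρ.dilation _ (inv_pos.2 h0), inv_mul_le_iff₀ h0, mul_one]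
      exact hw
    have h1 : ρ (SteinWeiss.dilation ν t⁻¹ x * SteinWeiss.dilation ν t⁻¹ y) ≤ K :=
      hK ⟨(_, _), ⟨hin x (le_max_left _ _), hin y (le_max_right _ _)⟩, rfl⟩
    rw [← hG.dilation_mul _ (inv_pos.2 h0), hρ.dilation _ (inv_pos.2 h0), inv_mul_le_iff₀ h0] at h1
    calc ρ (x * y) ≤ t * K := h1
      _ ≤ max K 1 * t := by rw [mul_comm]; gcongr; exact le_max_left _ _

/-- A homogeneous group is a quasi-metric space with `d x y = ρ (y⁻¹ * x)`, on which Haar measure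
is upper regular with exponent the homogeneous dimension. -/
lemma IsHomogeneousQuasiNorm.exists_isUpperRegular (hG : IsHomogeneousGroup ν)
    {ρ : EuclideanSpace ℝ (Fin N) → ℝ} (hρ : IsHomogeneousQuasiNorm ν ρ)
    (hQ : 0 < homogeneousDim ν) (μ : Measure (EuclideanSpace ℝ (Fin N))) [μ.IsHaarMeasure] :
    ∃ K A, IsUpperRegular μ (fun x y => ρ (y⁻¹ * x)) K (homogeneousDim ν) A := by
  have := hG.isTopologicalGroup
  obtain ⟨K, hK1, hK⟩ := hρ.exists_mul_le hG
  have hfin : μ {x | ρ x ≤ 1} ≠ ⊤ := (hρ.isCompact_closedUnitBall hG).measure_lt_top.ne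
  refine ⟨K, (μ {x | ρ x ≤ 1}).toReal,
    { measurable := ?_, nonneg := fun x y => hρ.nonneg _, symm := fun x y => ?_, one_le := hK1,
      triangle := fun x y z => ?_, dim_pos := hQ, const_nonneg := ENNReal.toReal_nonneg,
      measure_ball_le := fun y r hr => ?_ }⟩
  · exact (hρ.continuous.comp ((continuous_snd.inv).mul continuous_fst)).measurable
  · rw [← hρ.inv, mul_inv_rev, inv_inv]
  · have := hK (z⁻¹ * y) (y⁻¹ * x)
    rwa [max_comm, mul_assoc, mul_inv_cancel_left] at this
  · have hsub : {x | ρ (y⁻¹ * x) < r} ⊆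
        (fun x => y⁻¹ * x) ⁻¹' (SteinWeiss.dilation ν r '' {x | ρ x ≤ 1}) := by
      intro x hx
      refine ⟨SteinWeiss.dilation ν r⁻¹ (y⁻¹ * x), ?_, dilation_dilation_inv hr _⟩
      have hx' : ρ (y⁻¹ * x) < r := hx
      simp only [Set.mem_ofPred_eq]
      rw [hρ.dilation _ (inv_pos.2 hr), inv_mul_le_iff₀ hr, mul_one]
      exact hx'.le
    refine (measure_mono hsub).trans_eq ?_
    rw [measure_preimage_mul, hG.measure_image_dilation μ hr, ENNReal.ofReal_mul (by positivity),
      ENNReal.ofReal_toReal hfin, mul_comm]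

end HomogeneousGroup

end SteinWeiss

theorem theorem2p4 {N : ℕ} [Group (EuclideanSpace ℝ (Fin N))] (ν : Fin N → ℝ)
    (hG : SteinWeiss.IsHomogeneousGroup ν)
    (μ : Measure (EuclideanSpace ℝ (Fin N))) [μ.IsHaarMeasure]
    (ρ : EuclideanSpace ℝ (Fin N) → ℝ) (hρ : SteinWeiss.IsHomogeneousQuasiNorm ν ρ)
    {𝕜 : Type*} [RCLike 𝕜]
    (Q : ℝ) (hQ : Q = SteinWeiss.homogeneousDim ν)
    (l p q p' q' α β : ℝ)
    (hl0 : 0 < l) (hlQ : l < Q) (hp : 1 < p) (hpq : p ≤ q)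
    (hp' : 1 / p + 1 / p' = 1) (hq' : 1 / q + 1 / q' = 1)
    (hα : α < Q / p') (hβ : β < Q / q) (hαβ : 0 ≤ α + β)
    (hscale : 1 / q = 1 / p + (α + β + l) / Q - 1) :
    ∃ C : ℝ, 0 < C ∧
      (∀ u : EuclideanSpace ℝ (Fin N) → 𝕜,
        MemLp (fun x => ρ x ^ α • u x) (ENNReal.ofReal p) μ →
          (∀ᵐ x ∂μ, Integrable (fun y => ρ (y⁻¹ * x) ^ (-l) • u y) μ) ∧
          MemLp (fun x => ρ x ^ (-β) • SteinWeiss.fractionalIntegral μ ρ l u x)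
            (ENNReal.ofReal q) μ ∧
          eLpNorm (fun x => ρ x ^ (-β) • SteinWeiss.fractionalIntegral μ ρ l u x)
              (ENNReal.ofReal q) μ
            ≤ ENNReal.ofReal C * eLpNorm (fun x => ρ x ^ α • u x) (ENNReal.ofReal p) μ) ∧
      (∀ u h : EuclideanSpace ℝ (Fin N) → 𝕜,
        MemLp u (ENNReal.ofReal p) μ → MemLp h (ENNReal.ofReal q') μ →
          Integrable (fun z : EuclideanSpace ℝ (Fin N) × EuclideanSpace ℝ (Fin N) =>
            (ρ z.1 ^ (-β) * ρ (z.2⁻¹ * z.1) ^ (-l) * ρ z.2 ^ (-α)) • (u z.2 * h z.1))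
            (μ.prod μ) ∧
          ‖∫ z : EuclideanSpace ℝ (Fin N) × EuclideanSpace ℝ (Fin N),
              (ρ z.1 ^ (-β) * ρ (z.2⁻¹ * z.1) ^ (-l) * ρ z.2 ^ (-α)) • (u z.2 * h z.1)
              ∂(μ.prod μ)‖ₑ
            ≤ ENNReal.ofReal C * eLpNorm u (ENNReal.ofReal p) μ *
                eLpNorm h (ENNReal.ofReal q') μ) := by
  have := hG.isTopologicalGroup
  subst hQ
  have hQ0 : 0 < SteinWeiss.homogeneousDim ν := hl0.trans hlQ
  have hpp : p.HolderConjugate p' :=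
    Real.holderConjugate_iff.2 ⟨hp, by rwa [one_div, one_div] at hp'⟩
  have hqq : q.HolderConjugate q' :=
    Real.holderConjugate_iff.2 ⟨hp.trans_le hpq, by rwa [one_div, one_div] at hq'⟩
  obtain ⟨K, A, H⟩ := hρ.exists_isUpperRegular hG hQ0 μ
  have hsc : α + β + l = SteinWeiss.homogeneousDim ν / p' + SteinWeiss.homogeneousDim ν / q := by
    have h1 : 1 / p = 1 - 1 / p' := by linarith
    rw [h1] at hscale
    have h2 : (α + β + l) / SteinWeiss.homogeneousDim ν = 1 / p' + 1 / q := by linarith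
    rw [div_eq_iff hQ0.ne'] at h2
    rw [h2]
    ring
  -- The base point of the quasi-metric space is the identity of the group, where `d x 1 = ρ x`.
  obtain ⟨C, hC, h1, h2⟩ := H.steinWeiss (𝕜 := 𝕜) 1 hpp hqq hpq hl0.le hlQ hα hβ hαβ hsc
  simp only [inv_one, one_mul, SteinWeiss.kernel] at h1 h2
  exact ⟨C, hC, h1, h2⟩
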